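/- Let $V:\mathbb R^n\to\mathbb R$ be differentiable and such that $d\mu=e^{-V(x)}dx$ is a probability measure. Let $L=\Delta-\nabla V\cdot\nabla$ be the symmetric diffusion generator in $L^2(\mu)$, that is, $-L$ is the nonnegative self-adjoint operator of the closure of the Dirichlet form $\int\nabla f\cdot\nabla g\,d\mu$, $f,g\in C_c^\infty(\mathbb R^n)$, and let $P_t=e^{tL}$. Write $\mu(f)=\int f\,d\mu$ and $\mathrm{Var}_\mu(f)=\mu(f^2)-\mu(f)^2$. An $N$-function is a continuous, even, convex function $\Phi:\mathbb R\to[0,\infty)$ with $\Phi(x)=0\Leftrightarrow x=0$, $\Phi(x)/x\to\infty$ as $x\to\infty$ and $\Phi'(0_+)=0$; its conjugate is $\Phi^*(y)=\sup_{x\ge0}(x|y|-\Phi(x))$, with inverse $(\Phi^*)^{-1}$ on $[0,\infty)$, and the Luxemburg norm is $\|f\|_\Phi=\inf\{\lambda>0:\int\Phi(f/\lambda)\,d\mu\le1\}$. Let $m$ be a $C^1$ decreasing bijection of $(0,\infty)$ onto itself such that $m'$ is an increasing bijection of $(0,\infty)$ onto $(-\infty,0)$. Suppose that $m$ satisfies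 condition $(D)$ with a constant $\gamma>0$: for $M=-\log m$, one has $M'(u)\ge\gamma M'(t)$ for all $t>0$ and $u\in[t,2t]$. Set $\theta(x)=-m'(m^{-1}(2x))/x$ for $x>0$. Let $\psi:[0,\infty)\to[0,\infty)$ be continuous and strictly increasing with $\psi(0)=0$ and $\lim_{+\infty}\psi=+\infty$, and let $\Phi$ and $\Psi(x)=x^2/\psi(|x|)$ (with $\Psi(0)=0$) be two $N$-functions such that $\theta=(\Phi^*)^{-1}\circ\Psi\circ\psi^{-1}$ on $(0,\infty)$. Consider the properties (i) for all $t>0$ and all $f\in L^2(\mu)$, $$\mathrm{Var}_\mu(P_tf)\le m(t)\,\|f-\mu(f)\|_\Psi^2;$$ (ii)$_C$ for all smooth $f\in L^2(\mu)$, $$\mathrm{Var}_\mu(f)\,\theta\!\left(\frac12\,\frac{\mathrm{Var}_\mu(f)}{\|f-\mu(f)\|_\Psi^2}\right)\le C\int|\nabla f|^2\,d\mu$$ (the left side is $0$ if $f$ is constant, and the right side may be infinite). Then (i) and (ii) are equivalent up to constants: (i) implies (ii)$_C$ with $C=8/\gamma$, and (ii)$_C$ with $C=2$ implies (i). -/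

import Mathlib

open MeasureTheory ProbabilityTheory Set Filter Topology
open scoped ContDiff ENNReal

noncomputable section

namespace NashDecay

/-! ### N-functions, conjugates, Luxemburg norms -/

/-- The inverse on `[0, ∞)` of an increasing bijection of `[0, ∞)` onto itself. -/
def invNonneg (g : ℝ → ℝ) : ℝ → ℝ := Function.invFunOn g (Ici 0)

/-- The inverse on `(0, ∞)` of a decreasing bijection of `(0, ∞)` onto itself. -/
def invPos (g : ℝ → ℝ) : ℝ → ℝ := Function.invFunOn g (Ioi 0)

/-- An `N`-function: a finite, continuous, even, convex function on `ℝ`, vanishing exactly at `0`,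
superlinear at infinity, and with right derivative `0` at the origin. -/
structure IsNFunction (Φ : ℝ → ℝ) : Prop where
  convexOn : ConvexOn ℝ univ Φ
  continuous : Continuous Φ
  even : ∀ x, Φ (-x) = Φ x
  nonneg : ∀ x, 0 ≤ Φ x
  eq_zero_iff : ∀ x, Φ x = 0 ↔ x = 0
  superlinear : Tendsto (fun x => Φ x / x) atTop atTop
  rightDeriv_zero : HasDerivWithinAt Φ 0 (Ioi 0) 0

/-- The conjugate function `Φ*(y) = sup_{x ≥ 0} (x|y| - Φ(x))`
(a supremum of a set bounded above when `Φ` is an `N`-function). -/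
def conjugate (Φ : ℝ → ℝ) (y : ℝ) : ℝ := sSup ((fun x => x * |y| - Φ x) '' Ici 0)

/-- The Luxemburg norm `inf {l > 0 : ∫ Φ(f / l) dμ ≤ 1}`. -/
def luxemburgNorm {α : Type*} [MeasurableSpace α] (Φ : ℝ → ℝ) (μ : Measure α) (f : α → ℝ) : ℝ :=
  sInf {l : ℝ | 0 < l ∧ ∫⁻ x, ENNReal.ofReal (Φ (f x / l)) ∂μ ≤ 1}

/-- The function `Ψ(x) = x² / ψ(|x|)`; its value at `0` is `0`. -/
def quotientFunction (ψ : ℝ → ℝ) (x : ℝ) : ℝ := x ^ 2 / ψ |x|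

/-! ### The measure and the symmetric diffusion semigroup -/

/-- The measure `e^{-V(x)} dx` on `ℝⁿ`. -/
def gibbsMeasure {n : ℕ} (V : EuclideanSpace ℝ (Fin n) → ℝ) :
    Measure (EuclideanSpace ℝ (Fin n)) :=
  volume.withDensity (fun x => ENNReal.ofReal (Real.exp (-V x)))

/-- The gradient of a complex-valued function on `ℝⁿ`. -/
def complexGradient {n : ℕ} (φ : EuclideanSpace ℝ (Fin n) → ℂ) (x : EuclideanSpace ℝ (Fin n)) :
    EuclideanSpace ℂ (Fin n) :=
  WithLp.toLp 2 (fun i => fderiv ℝ φ x (EuclideanSpace.single i 1))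

/-- For a closed subspace `K` of `H × G`, the operator `u ↦ pr₁ (proj_K (u, 0))` on `H`. If `K` is the
graph of a closed densely defined operator `D` from `H` to `G`, this is `(1 + D* D)⁻¹`.
Here `u ↦ (u, 0)` is written as the adjoint of the first projection. -/
def graphResolvent {H G : Type*} [NormedAddCommGroup H] [InnerProductSpace ℂ H] [CompleteSpace H]
    [NormedAddCommGroup G] [InnerProductSpace ℂ G] [CompleteSpace G]
    (K : Submodule ℂ (WithLp 2 (H × G))) [K.HasOrthogonalProjection] : H →L[ℂ] H :=
  WithLp.fstL 2 ℂ H G ∘L K.starProjection ∘L (WithLp.fstL 2 ℂ H G).adjoint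

/-- This operator is self-adjoint, so that the functional calculus applies to it. -/
theorem isSelfAdjoint_graphResolvent {H G : Type*}
    [NormedAddCommGroup H] [InnerProductSpace ℂ H] [CompleteSpace H]
    [NormedAddCommGroup G] [InnerProductSpace ℂ G] [CompleteSpace G]
    (K : Submodule ℂ (WithLp 2 (H × G))) [K.HasOrthogonalProjection] :
    IsSelfAdjoint (graphResolvent K) :=
  (isSelfAdjoint_starProjection K).conj_adjoint (WithLp.fstL 2 ℂ H G)

/-- The closed graph of the gradient: the closure in `L²(μ; ℂ) × L²(μ; ℂⁿ)` of all pairs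
`(φ, ∇φ)` with `φ` smooth and compactly supported. Its elements are the pairs `(f, ∇f)` with `f` in
the domain of the closed Dirichlet form `ℰ(f, g) = ∫ ∇f · ∇g dμ`. (These pairs already form a
subspace, on which the `span` has no effect.) -/
def gradientGraph {n : ℕ} (μ : Measure (EuclideanSpace ℝ (Fin n))) :
    Submodule ℂ (WithLp 2 (Lp ℂ 2 μ × Lp (EuclideanSpace ℂ (Fin n)) 2 μ)) :=
  (Submodule.span ℂ {p | ∃ φ : EuclideanSpace ℝ (Fin n) → ℂ,
    ContDiff ℝ ∞ φ ∧ HasCompactSupport φ ∧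
      (p.fst : EuclideanSpace ℝ (Fin n) → ℂ) =ᵐ[μ] φ ∧
      (p.snd : EuclideanSpace ℝ (Fin n) → EuclideanSpace ℂ (Fin n)) =ᵐ[μ]
        complexGradient φ}).topologicalClosure

instance {n : ℕ} (μ : Measure (EuclideanSpace ℝ (Fin n))) :
    CompleteSpace (gradientGraph μ) :=
  inferInstanceAs (CompleteSpace (Submodule.topologicalClosure _))

/-- The resolvent `J = (1 - L)⁻¹` on `L²(μ; ℂ)`, where `-L` is the nonnegative self-adjoint operator
of the closed Dirichlet form `∫ ∇f · ∇g dμ` (so `L = Δ - ∇V · ∇` when `dμ = e^{-V} dx`).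
For `u ∈ L²`, the pair `(J u, ∇ J u)` is the orthogonal projection of `(u, 0)` on the closed graph
of the gradient, that is, `⟨J u, φ⟩ + ∫ ∇ J u · ∇φ dμ = ⟨u, φ⟩` for all `φ` in the form domain. -/
def resolvent {n : ℕ} (μ : Measure (EuclideanSpace ℝ (Fin n))) : Lp ℂ 2 μ →L[ℂ] Lp ℂ 2 μ :=
  graphResolvent (gradientGraph μ)

/-- The function `e^{-tλ}` of `λ ≥ 0`, in the variable `r = (1 + λ)⁻¹ ∈ (0, 1]`, extended by `0`
to `r ≤ 0`. -/
def heatSymbol (t r : ℝ) : ℝ := if r ≤ 0 then 0 else Real.exp (-t * (r⁻¹ - 1))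

/-- For `t > 0` and `J = (1 + A)⁻¹` with `A` nonnegative self-adjoint, the operator `e^{-tA}`, through
the continuous functional calculus of the bounded self-adjoint operator `J`. -/
def expOfResolvent {H : Type*} [NormedAddCommGroup H] [InnerProductSpace ℂ H] [CompleteSpace H]
    (J : H →L[ℂ] H) (t : ℝ) : H →L[ℂ] H :=
  cfc (heatSymbol t) J

/-- The semigroup `P_t = e^{tL}`, `t > 0`, on `L²(μ; ℂ)`. -/
def semigroup {n : ℕ} (μ : Measure (EuclideanSpace ℝ (Fin n))) (t : ℝ) :
    Lp ℂ 2 μ →L[ℂ] Lp ℂ 2 μ :=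
  expOfResolvent (resolvent μ) t

/-- `P_t f` for a real-valued `f ∈ L²(μ)`. -/
def heat {n : ℕ} (μ : Measure (EuclideanSpace ℝ (Fin n))) (t : ℝ)
    (f : EuclideanSpace ℝ (Fin n) → ℝ) (hf : MemLp f 2 μ) (x : EuclideanSpace ℝ (Fin n)) : ℝ :=
  (semigroup μ t (MemLp.toLp (fun y => (f y : ℂ)) hf.ofReal) x).re

/-- For `t > 0` the symbol is continuous, so that the functional calculus applies to it. -/
theorem continuous_heatSymbol {t : ℝ} (ht : 0 < t) : Continuous (heatSymbol t) := by
  rw [continuous_iff_continuousAt]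
  intro r
  rcases lt_trichotomy r 0 with h | h | h
  · refine (continuousAt_const (y := (0 : ℝ))).congr ?_
    filter_upwards [Iio_mem_nhds h] with s hs
    simp [heatSymbol, le_of_lt (mem_Iio.mp hs)]
  · subst h
    rw [ContinuousAt, ← nhdsLE_sup_nhdsGT (0 : ℝ), tendsto_sup]
    have h0 : heatSymbol t 0 = 0 := by simp [heatSymbol]
    rw [h0]
    constructor
    · refine tendsto_const_nhds.congr' ?_
      filter_upwards [self_mem_nhdsWithin] with s hs
      simp [heatSymbol, mem_Iic.mp hs]
    · have h1 : Tendsto (fun s : ℝ => t * (s⁻¹ - 1)) (𝓝[>] 0) atTop :=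
        (tendsto_atTop_add_const_right _ (-1) tendsto_inv_nhdsGT_zero).const_mul_atTop ht
      refine (Real.tendsto_exp_neg_atTop_nhds_zero.comp h1).congr' ?_
      filter_upwards [self_mem_nhdsWithin] with s hs
      simp [heatSymbol, not_le.mpr (mem_Ioi.mp hs)]
  · have h1 : ContinuousAt (fun s : ℝ => Real.exp (-t * (s⁻¹ - 1))) r := by
      have : r ≠ 0 := h.ne'
      fun_prop (disch := assumption)
    refine h1.congr ?_
    filter_upwards [Ioi_mem_nhds h] with s hs
    simp [heatSymbol, not_le.mpr (mem_Ioi.mp hs)]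

/-! ### The two properties -/

/-- Condition (D) with constant `γ` for `m : (0, ∞) → (0, ∞)`: the function `M = -log m`
satisfies `M'(u) ≥ γ M'(t)` for all `t > 0` and `u ∈ [t, 2t]`. -/
def ConditionD (m : ℝ → ℝ) (γ : ℝ) : Prop :=
  ∀ t > 0, ∀ u ∈ Icc t (2 * t),
    γ * deriv (fun s => -Real.log (m s)) t ≤ deriv (fun s => -Real.log (m s)) u

/-- The function `θ(x) = -m'(m⁻¹(2x)) / x`, `x > 0`. -/
def rate (m : ℝ → ℝ) (x : ℝ) : ℝ := -deriv m (invPos m (2 * x)) / x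

/-- Decay to equilibrium: `Var(P_t f) ≤ m(t) ‖f - μ(f)‖_Ψ²` for all `t > 0` and `f ∈ L²(μ)`. -/
def DecayBound {n : ℕ} (μ : Measure (EuclideanSpace ℝ (Fin n))) (m Ψ : ℝ → ℝ) : Prop :=
  ∀ t > 0, ∀ (f : EuclideanSpace ℝ (Fin n) → ℝ) (hf : MemLp f 2 μ),
    variance (heat μ t f hf) μ ≤ m t * luxemburgNorm Ψ μ (fun x => f x - ∫ y, f y ∂μ) ^ 2

/-- The Nash-type inequality
`Var(f) θ(Var(f) / (2 ‖f - μ(f)‖_Ψ²)) ≤ C ∫ |∇f|² dμ` for all smooth `f ∈ L²(μ)`. The left side is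
`0` when `f` is constant, and the right side may be infinite. -/
def NashInequality {n : ℕ} (μ : Measure (EuclideanSpace ℝ (Fin n))) (θ Ψ : ℝ → ℝ) (C : ℝ) : Prop :=
  ∀ f : EuclideanSpace ℝ (Fin n) → ℝ, ContDiff ℝ ∞ f → MemLp f 2 μ →
    ENNReal.ofReal (variance f μ *
      θ (1 / 2 * (variance f μ / luxemburgNorm Ψ μ (fun x => f x - ∫ y, f y ∂μ) ^ 2)))
      ≤ ENNReal.ofReal C * ∫⁻ x, ‖gradient f x‖ₑ ^ 2 ∂μ

end NashDecay

end

/-! Write `g = f - μ(f)`, `N = ‖g‖_Ψ`, `v(t) = Var(P_t f) = ‖P_t g‖²`, and `ℰ` for the Dirichlet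
form. With `v = N² m(s)`, the left side of the Nash inequality is `-2 N² m'(s)` (`mul_rate_eq`).

Nash to decay. One has `v' = -2 ℰ(P_t g)`. Since `P_t` is Markov and `Ψ` is convex, Jensen gives
`‖P_t g‖_Ψ ≤ N` (`luxemburgNorm_heat_le`). As `θ` is nondecreasing, being a composition of
nondecreasing functions (`monotoneOn_rate`), the Nash inequality for `P_t g` becomes `v θ(v / (2N²))
≤ -v'`. The clock `σ = m⁻¹(v / N²)` then has speed at least `2`, whence `σ(t) ≥ t` and `v(t) ≤ m(t)
N²` (`le_mul_of_rate_le`).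

Decay to Nash. Jensen's inequality for the spectral measure of `g` gives `v(0) exp(-2t ℰ(g) / v(0))
≤ v(t) ≤ m(t) N²` (`norm_sq_mul_exp_le`). Choosing `t₀` with `m(t₀) = v(0) / N²` and evaluating at
`2t₀`, condition (D) bounds the growth of `-log m` on `[t₀, 2t₀]` below by `γ t₀` times its slope at
`t₀` (`mul_rate_le_of_decay`).

The semigroup is known only through the projection on the graph of the gradient, so its properties
are derived from there. Every `P_t u` is `J b` with `b = (1 - L) P_t u` (`expOfResolvent_apply_eq`).
Testing the resolvent equation with `η(φ)`, `η` nondecreasing, makes `∫ H(P_t u) dμ` nonincreasing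
for `H' = η`, hence positivity (`semigroup_nonneg`); cutoffs put the constants in the form domain,
hence `P_t 1 = 1`. Finally the Nash inequality passes from test functions to the range of `J` by
approximation (`NashInequality.mul_rate_le_resolvent`). -/

noncomputable section

namespace NashDecay

set_option linter.unusedSectionVars false

/-! ### The resolvent as a projection on a closed graph -/

section Resolvent

variable {H G : Type*} [NormedAddCommGroup H] [InnerProductSpace ℂ H] [CompleteSpace H]
  [NormedAddCommGroup G] [InnerProductSpace ℂ G] [CompleteSpace G]

/-- The projection of `(a, 0)` on `K`. If `K` is the graph of `D`, this is `(J a, D J a)` with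
`J = (1 + D* D)⁻¹`. -/
def graphLift (K : Submodule ℂ (WithLp 2 (H × G))) [K.HasOrthogonalProjection] (a : H) :
    WithLp 2 (H × G) :=
  K.starProjection (WithLp.toLp 2 (a, 0))

variable (K : Submodule ℂ (WithLp 2 (H × G))) [K.HasOrthogonalProjection]

theorem adjoint_fstL_apply (a : H) :
    (WithLp.fstL 2 ℂ H G).adjoint a = WithLp.toLp 2 (a, 0) := by
  refine ext_inner_left ℂ fun v => ?_
  rw [ContinuousLinearMap.adjoint_inner_right]
  simp [WithLp.prod_inner_apply]

theorem graphLift_mem (a : H) : graphLift K a ∈ K :=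
  Submodule.starProjection_apply_mem _ _

theorem fst_graphLift (a : H) : (graphLift K a).fst = graphResolvent K a := by
  simp [graphResolvent, graphLift, adjoint_fstL_apply]

/-- The projection is self-adjoint and fixes `k`. This is the weak equation `⟨φ, Ja⟩ + ⟨∇φ, ∇Ja⟩ =
⟨φ, a⟩`, through which the form enters all later arguments. -/
theorem inner_graphLift {k : WithLp 2 (H × G)} (hk : k ∈ K) (a : H) :
    inner ℂ k (graphLift K a) = inner ℂ k.fst a := by
  rw [graphLift, ← Submodule.inner_starProjection_left_eq_right,
    (Submodule.starProjection_eq_self_iff).2 hk]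
  simp [WithLp.prod_inner_apply]

theorem norm_sq_graphLift (a : H) :
    ‖graphLift K a‖ ^ 2 = (inner ℂ (graphResolvent K a) a).re := by
  rw [← fst_graphLift, ← inner_graphLift K (graphLift_mem K a)]
  exact (inner_self_eq_norm_sq (𝕜 := ℂ) (graphLift K a)).symm

theorem norm_graphLift_le (a : H) : ‖graphLift K a‖ ≤ ‖a‖ := by
  refine (Submodule.norm_starProjection_apply_le _ _).trans_eq ?_
  rw [WithLp.norm_toLp_fst]

theorem norm_graphResolvent_le : ‖graphResolvent K‖ ≤ 1 := by
  refine ContinuousLinearMap.opNorm_le_bound _ zero_le_one fun a => ?_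
  rw [one_mul, ← fst_graphLift]
  exact (WithLp.norm_fst_le _ _).trans (norm_graphLift_le K a)

theorem spectrum_graphResolvent : spectrum ℝ (graphResolvent K) ⊆ Icc 0 1 := by
  intro r hr
  constructor
  · have h0 : 0 ≤ graphResolvent K := by
      rw [ContinuousLinearMap.nonneg_iff_isPositive]
      refine ⟨(isSelfAdjoint_graphResolvent K).isSymmetric, fun a => ?_⟩
      exact (sq_nonneg _).trans_eq (norm_sq_graphLift K a)
    exact spectrum_nonneg_of_nonneg h0 hr
  · have h1 := spectrum.norm_le_norm_mul_of_mem hr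
    have h2 : ‖(1 : H →L[ℂ] H)‖ ≤ 1 := ContinuousLinearMap.norm_id_le
    have h3 := norm_graphResolvent_le K
    calc r ≤ ‖r‖ := Real.le_norm_self r
      _ ≤ _ := h1
      _ ≤ 1 * 1 := by gcongr
      _ = 1 := one_mul 1

/-- If `Ja = 0`, then the lift has norm `0`, so `a` is orthogonal to every first component of `K`,
and these are dense. -/
theorem graphResolvent_injective
    (hK : Dense {u : H | ∃ k ∈ K, k.fst = u}) : Function.Injective (graphResolvent K) := by
  rw [injective_iff_map_eq_zero]
  intro a ha
  have h0 : graphLift K a = 0 := by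
    have := norm_sq_graphLift K a
    rw [ha, inner_zero_left] at this
    simpa using this
  refine hK.eq_zero_of_inner_right ℂ ?_
  rintro _ ⟨k, hk, rfl⟩
  rw [← inner_graphLift K hk, h0, inner_zero_right]

/-- Expand `‖k - graphLift K a‖² ≥ 0`. This variational lower bound for the form compares it with
functions of `J`. -/
theorem sub_le_norm_sq_of_mem {k : WithLp 2 (H × G)} (hk : k ∈ K) (a : H) :
    2 * (inner ℂ k.fst a).re - (inner ℂ (graphResolvent K a) a).re ≤
      ‖k.fst‖ ^ 2 + ‖k.snd‖ ^ 2 := by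
  rw [← WithLp.prod_norm_sq_eq_of_L2, ← norm_sq_graphLift, ← inner_graphLift K hk]
  have := norm_sub_sq (𝕜 := ℂ) k (graphLift K a)
  simp only [RCLike.re_to_complex] at this
  nlinarith [sq_nonneg ‖k - graphLift K a‖]

/-- Pythagoras: among elements of `K`, being nearer to `(a, 0)` is the same as being nearer to its
projection. -/
theorem norm_sq_sub_of_mem {k : WithLp 2 (H × G)} (hk : k ∈ K) (a : H) :
    ‖WithLp.toLp 2 (a, 0) - k‖ ^ 2 =
      ‖WithLp.toLp 2 (a, 0) - graphLift K a‖ ^ 2 + ‖graphLift K a - k‖ ^ 2 := by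
  have h : inner ℂ (WithLp.toLp 2 (a, (0 : G)) - graphLift K a) (graphLift K a - k) = 0 :=
    Submodule.starProjection_inner_eq_zero _ _ (K.sub_mem (graphLift_mem K a) hk)
  have h2 := norm_add_sq_eq_norm_sq_add_norm_sq_of_inner_eq_zero _ _ h
  rw [sub_add_sub_cancel] at h2
  simpa only [sq] using h2

theorem graphResolvent_eq_self {k : WithLp 2 (H × G)} (hk : k ∈ K) (h0 : k.snd = 0) :
    graphResolvent K k.fst = k.fst := by
  have e : WithLp.toLp 2 (k.fst, (0 : G)) = k := by
    rw [← h0]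
    rfl
  rw [← fst_graphLift, graphLift, e, (Submodule.starProjection_eq_self_iff).2 hk]

end Resolvent

/-! ### Functional calculus of an operator with spectrum in `[0, 1]` -/

section Calculus

variable {H : Type*} [NormedAddCommGroup H] [InnerProductSpace ℂ H] [CompleteSpace H]
  {J : H →L[ℂ] H}

/-- The operator `f(J)`, for a real continuous function `f` and a self-adjoint `J`. -/
def functionalCalculus (f : ℝ → ℝ) (J : H →L[ℂ] H) : H →L[ℂ] H := cfc f J

theorem re_inner_cfc_mono (hs : spectrum ℝ J ⊆ Icc 0 1) {f g : ℝ → ℝ}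
    (hf : ContinuousOn f (Icc 0 1)) (hg : ContinuousOn g (Icc 0 1))
    (h : ∀ r ∈ Icc (0 : ℝ) 1, f r ≤ g r) (u : H) :
    (inner ℂ (cfc f J u) u).re ≤ (inner ℂ (cfc g J u) u).re := by
  have h1 : cfc f J ≤ cfc g J := cfc_mono (fun x hx => h x (hs hx)) (hf.mono hs) (hg.mono hs)
  have h2 := ((ContinuousLinearMap.le_def _ _).1 h1).re_inner_nonneg_left u
  simpa [inner_sub_left] using h2

theorem norm_cfc_apply_le (hs : spectrum ℝ J ⊆ Icc 0 1) {f : ℝ → ℝ} {c : ℝ} (hc : 0 ≤ c)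
    (h : ∀ r ∈ Icc (0 : ℝ) 1, |f r| ≤ c) (u : H) : ‖cfc f J u‖ ≤ c * ‖u‖ :=
  (ContinuousLinearMap.le_opNorm _ _).trans
    (mul_le_mul_of_nonneg_right (norm_cfc_le hc fun x hx => h x (hs hx)) (norm_nonneg _))

theorem inner_cfc_left (f : ℝ → ℝ) (u v : H) :
    inner ℂ (cfc f J u) v = inner ℂ u (cfc f J v) :=
  (cfc_predicate f J : IsSelfAdjoint (cfc f J)).isSymmetric u v

theorem norm_sq_cfc_apply (hs : spectrum ℝ J ⊆ Icc 0 1) {f : ℝ → ℝ}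
    (hf : ContinuousOn f (Icc 0 1)) (u : H) :
    ‖cfc f J u‖ ^ 2 = (inner ℂ (cfc (fun r => f r * f r) J u) u).re := by
  rw [cfc_mul f f J (hf.mono hs) (hf.mono hs), mul_apply_eq_comp, inner_cfc_left]
  exact (inner_self_eq_norm_sq (𝕜 := ℂ) _).symm

theorem apply_cfc_apply (hJ : IsSelfAdjoint J) (hs : spectrum ℝ J ⊆ Icc 0 1) {f : ℝ → ℝ}
    (hf : ContinuousOn f (Icc 0 1)) (u : H) :
    J (cfc f J u) = cfc (fun r => r * f r) J u := by
  rw [cfc_mul (fun r => r) f J continuousOn_id (hf.mono hs), cfc_id' ℝ J]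
  rfl

/-- The functional calculus is a limit of polynomials. -/
theorem exists_polynomial_near_cfc (hJ : IsSelfAdjoint J) (hs : spectrum ℝ J ⊆ Icc 0 1)
    {f : ℝ → ℝ} (hf : ContinuousOn f (Icc 0 1)) {ε : ℝ} (hε : 0 < ε) :
    ∃ p : Polynomial ℝ, (∀ r ∈ Icc (0 : ℝ) 1, |p.eval r - f r| < ε) ∧
      ‖Polynomial.aeval J p - cfc f J‖ ≤ ε := by
  obtain ⟨p, hp⟩ := exists_polynomial_near_of_continuousOn 0 1 f hf ε hε
  refine ⟨p, hp, ?_⟩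
  rw [← cfc_polynomial p J hJ, ← cfc_sub _ _ J p.continuous.continuousOn (hf.mono hs)]
  exact norm_cfc_le hε.le fun x hx => (hp x (hs hx)).le

/-- Real polynomials in `J` preserve `S`, and `S` is closed. Only real scalars are asked for,
because real-valued functions do not form a complex subspace. -/
theorem functionalCalculus_apply_mem (hJ : IsSelfAdjoint J) (hs : spectrum ℝ J ⊆ Icc 0 1)
    {f : ℝ → ℝ} (hf : ContinuousOn f (Icc 0 1)) (S : AddSubgroup H) (hS : IsClosed (S : Set H))
    (hsmul : ∀ (r : ℝ), ∀ u ∈ S, (r : ℂ) • u ∈ S)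
    (hJS : ∀ u ∈ S, J u ∈ S) {u : H} (hu : u ∈ S) :
    functionalCalculus f J u ∈ S := by
  rw [functionalCalculus]
  have hpow : ∀ k : ℕ, (J ^ k) u ∈ S := by
    intro k
    induction k with
    | zero => simpa using hu
    | succ k ih => rw [pow_succ']; exact hJS _ ih
  have hpoly : ∀ p : Polynomial ℝ, Polynomial.aeval J p u ∈ S := by
    intro p
    rw [Polynomial.aeval_eq_sum_range, sum_apply]
    refine S.sum_mem fun i _ => ?_
    rw [smul_apply, ← Complex.coe_smul]
    exact hsmul _ _ (hpow i)
  -- The default value `0` for `ε ≤ 0` also lies in `S`, so membership holds for every `ε`.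
  refine hS.mem_of_frequently_of_tendsto (b := 𝓝[>] (0:ℝ)) (f := fun ε =>
    if h : 0 < ε then Polynomial.aeval J (exists_polynomial_near_cfc hJ hs hf h).choose u else 0)
    (Frequently.of_forall fun ε => ?_) ?_
  · split_ifs with h
    · exact hpoly _
    · exact S.zero_mem
  · rw [tendsto_iff_norm_sub_tendsto_zero]
    have : Tendsto (fun ε : ℝ => ε * ‖u‖) (𝓝[>] 0) (𝓝 0) := by
      have := (continuous_mul_const ‖u‖).tendsto (0 : ℝ)
      simpa using this.mono_left nhdsWithin_le_nhds
    refine squeeze_zero' (Eventually.of_forall fun _ => norm_nonneg _) ?_ this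
    filter_upwards [self_mem_nhdsWithin] with ε hε
    rw [dif_pos (mem_Ioi.1 hε)]
    have h := (exists_polynomial_near_cfc hJ hs hf (mem_Ioi.1 hε)).choose_spec.2
    rw [← sub_apply]
    exact (ContinuousLinearMap.le_opNorm _ _).trans (by gcongr)

/-- For polynomials, `p(J) e = p(1) e`. The approximation is uniform on all of `[0, 1]`, so it may
be evaluated at `1` without knowing that `1` is in the spectrum. -/
theorem functionalCalculus_apply_of_fixed (hJ : IsSelfAdjoint J) (hs : spectrum ℝ J ⊆ Icc 0 1)
    {f : ℝ → ℝ} (hf : ContinuousOn f (Icc 0 1)) {e : H} (he : J e = e) :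
    functionalCalculus f J e = (f 1 : ℂ) • e := by
  rw [functionalCalculus]
  have hpow : ∀ k : ℕ, (J ^ k) e = e := by
    intro k
    induction k with
    | zero => simp
    | succ k ih => rw [pow_succ', mul_apply_eq_comp, ih, he]
  have hpoly : ∀ p : Polynomial ℝ, Polynomial.aeval J p e = ((p.eval 1 : ℝ) : ℂ) • e := by
    intro p
    rw [Polynomial.aeval_eq_sum_range, sum_apply, Polynomial.eval_eq_sum_range]
    simp only [smul_apply, hpow, ← Finset.sum_smul, one_pow, mul_one]
    rfl
  rw [← sub_eq_zero, ← norm_le_zero_iff]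
  refine le_of_forall_pos_le_add fun δ hδ => ?_
  have hpos : 0 < δ / (2 * (‖e‖ + 1)) := by positivity
  obtain ⟨p, hp1, hp2⟩ := exists_polynomial_near_cfc hJ hs hf hpos
  have h1 : ‖(Polynomial.aeval J p - cfc f J) e‖ ≤ δ / (2 * (‖e‖ + 1)) * ‖e‖ :=
    (ContinuousLinearMap.le_opNorm _ _).trans (by gcongr)
  have h2 : ‖((p.eval 1 - f 1 : ℝ) : ℂ) • e‖ ≤ δ / (2 * (‖e‖ + 1)) * ‖e‖ := by
    rw [norm_smul, Complex.norm_real]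
    gcongr
    exact (hp1 1 (by simp)).le
  have h3 : cfc f J e - (f 1 : ℂ) • e =
      ((p.eval 1 - f 1 : ℝ) : ℂ) • e - (Polynomial.aeval J p - cfc f J) e := by
    rw [sub_apply, hpoly]
    push_cast
    rw [sub_smul]
    abel
  rw [h3, zero_add]
  have h4 : δ / (2 * (‖e‖ + 1)) * ‖e‖ ≤ δ / 2 := by
    rw [div_mul_eq_mul_div, div_le_div_iff₀ (by positivity) (by positivity)]
    nlinarith [norm_nonneg e]
  linarith [norm_sub_le (((p.eval 1 - f 1 : ℝ) : ℂ) • e) ((Polynomial.aeval J p - cfc f J) e)]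

end Calculus

/-! ### The heat semigroup: smoothing, derivative, strong continuity -/

section Semigroup

variable {H : Type*} [NormedAddCommGroup H] [InnerProductSpace ℂ H] [CompleteSpace H]
  {J : H →L[ℂ] H}

theorem heatSymbol_of_pos (t : ℝ) {r : ℝ} (hr : 0 < r) :
    heatSymbol t r = Real.exp (-t * (r⁻¹ - 1)) := if_neg hr.not_ge

theorem heatSymbol_of_nonpos (t : ℝ) {r : ℝ} (hr : r ≤ 0) : heatSymbol t r = 0 := if_pos hr

theorem heatSymbol_nonneg (t r : ℝ) : 0 ≤ heatSymbol t r := by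
  unfold heatSymbol
  split_ifs
  exacts [le_rfl, (Real.exp_pos _).le]

theorem heatSymbol_le_one {t r : ℝ} (ht : 0 ≤ t) (hr : r ≤ 1) : heatSymbol t r ≤ 1 := by
  rcases le_or_gt r 0 with h | h
  · rw [heatSymbol_of_nonpos t h]; exact zero_le_one
  · rw [heatSymbol_of_pos t h, Real.exp_le_one_iff]
    have : 1 ≤ r⁻¹ := (one_le_inv₀ h).2 hr
    nlinarith

theorem heatSymbol_mul_self (t r : ℝ) : heatSymbol t r * heatSymbol t r = heatSymbol (2 * t) r := by
  rcases le_or_gt r 0 with h | h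
  · simp [heatSymbol_of_nonpos _ h]
  · rw [heatSymbol_of_pos _ h, heatSymbol_of_pos _ h, ← Real.exp_add]
    ring_nf

/-- The function `(1 + λ) e^{-tλ}` in the variable `r = (1 + λ)⁻¹`. -/
def heatQuotient (t r : ℝ) : ℝ := heatSymbol t r * r⁻¹

theorem self_mul_heatQuotient (t r : ℝ) : r * heatQuotient t r = heatSymbol t r := by
  rcases eq_or_ne r 0 with rfl | h
  · simp [heatSymbol_of_nonpos]
  · rw [heatQuotient, mul_comm, inv_mul_cancel_right₀ h]

/-- From `e^y ≥ y² / 2` with `y = t / r`. Vanishing to second order at `r = 0` is what keeps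
`heatQuotient` continuous there. -/
theorem heatSymbol_le_sq {t r : ℝ} (ht : 0 < t) (hr : 0 < r) :
    heatSymbol t r ≤ 2 * Real.exp t / t ^ 2 * r ^ 2 := by
  have h1 : (t * r⁻¹) ^ 2 / 2 ≤ Real.exp (t * r⁻¹) := by
    have := Real.quadratic_le_exp_of_nonneg (x := t * r⁻¹) (by positivity)
    have : 0 ≤ t * r⁻¹ := by positivity
    linarith
  rw [heatSymbol_of_pos _ hr, show -t * (r⁻¹ - 1) = t - t * r⁻¹ by ring, Real.exp_sub,
    div_le_iff₀ (Real.exp_pos _)]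
  calc Real.exp t = 2 * Real.exp t / t ^ 2 * r ^ 2 * ((t * r⁻¹) ^ 2 / 2) := by field_simp
    _ ≤ _ := by gcongr

theorem continuous_heatQuotient {t : ℝ} (ht : 0 < t) : Continuous (heatQuotient t) := by
  rw [continuous_iff_continuousAt]
  intro r
  rcases eq_or_ne r 0 with rfl | h
  · have h0 : heatQuotient t 0 = 0 := by simp [heatQuotient]
    rw [ContinuousAt, h0]
    have hlim : Tendsto (fun r : ℝ => 2 * Real.exp t / t ^ 2 * |r|) (𝓝 0) (𝓝 0) := by
      have h : Continuous fun r : ℝ => 2 * Real.exp t / t ^ 2 * |r| := by fun_prop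
      simpa using h.tendsto 0
    refine squeeze_zero_norm (fun r => ?_) hlim
    rcases le_or_gt r 0 with h | h
    · rw [heatQuotient, heatSymbol_of_nonpos t h, zero_mul, norm_zero]
      positivity
    · rw [heatQuotient, Real.norm_of_nonneg (mul_nonneg (heatSymbol_nonneg _ _) (by positivity)),
        ← div_eq_mul_inv, div_le_iff₀ h, abs_of_pos h]
      exact (heatSymbol_le_sq ht h).trans_eq (by ring)
  · exact (continuous_heatSymbol ht).continuousAt.mul (continuousAt_inv₀ h)

theorem norm_expOfResolvent_apply_le (hs : spectrum ℝ J ⊆ Icc 0 1) {t : ℝ} (ht : 0 < t) (u : H) :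
    ‖expOfResolvent J t u‖ ≤ ‖u‖ := by
  have := norm_cfc_apply_le hs zero_le_one (f := heatSymbol t) (fun r hr => by
    rw [abs_of_nonneg (heatSymbol_nonneg _ _)]; exact heatSymbol_le_one ht.le hr.2) u
  rwa [one_mul] at this

/-- The smoothing effect: for every `u`, the vector `P_t u` is in the domain of the generator, with
`(1 - L) P_t u` given by `heatQuotient`. -/
theorem expOfResolvent_apply_eq (hJ : IsSelfAdjoint J) (hs : spectrum ℝ J ⊆ Icc 0 1)
    {t : ℝ} (ht : 0 < t) (u : H) :
    expOfResolvent J t u = J (functionalCalculus (heatQuotient t) J u) := by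
  rw [functionalCalculus, apply_cfc_apply hJ hs (continuous_heatQuotient ht).continuousOn]
  simp only [self_mul_heatQuotient]
  rfl

theorem norm_sq_expOfResolvent_apply (hs : spectrum ℝ J ⊆ Icc 0 1) {t : ℝ} (ht : 0 < t) (u : H) :
    ‖expOfResolvent J t u‖ ^ 2 = (inner ℂ (cfc (heatSymbol (2 * t)) J u) u).re := by
  rw [expOfResolvent, norm_sq_cfc_apply hs (continuous_heatSymbol ht).continuousOn]
  simp only [heatSymbol_mul_self]

theorem abs_exp_sub_one_sub_le (x : ℝ) : |Real.exp x - 1 - x| ≤ x ^ 2 * Real.exp |x| := by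
  have h := Complex.norm_exp_sub_sum_le_norm_mul_exp (x : ℂ) 2
  simp only [Finset.sum_range_succ, Finset.sum_range_zero] at h
  have h2 : Complex.exp x - (0 + (x : ℂ) ^ 0 / (Nat.factorial 0 : ℂ) +
      (x : ℂ) ^ 1 / (Nat.factorial 1 : ℂ)) = ((Real.exp x - 1 - x : ℝ) : ℂ) := by
    push_cast
    simp
    ring
  rw [h2, Complex.norm_real, Complex.norm_real, Real.norm_eq_abs, Real.norm_eq_abs, sq_abs] at h
  exact h

/-- With `λ = r⁻¹ - 1`, the difference `heatSymbol - heatQuotient` is `-λ e^{-tλ}`, the time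
derivative. The remainder is at most `h² λ² e^{-tλ} e^{|h|λ}`; as `|h| ≤ t/2`, a factor `e^{-tλ/2} ≤
8 / (tλ)²` survives and makes the bound uniform in `r`. -/
theorem abs_heatSymbol_taylor {t h r : ℝ} (ht : 0 < t) (hh : |h| ≤ t / 2) (hr : r ∈ Icc (0 : ℝ) 1) :
    |heatSymbol (t + h) r - heatSymbol t r - h * (heatSymbol t r - heatQuotient t r)| ≤
      8 / t ^ 2 * h ^ 2 := by
  rcases eq_or_lt_of_le hr.1 with rfl | h0
  · simp [heatQuotient, heatSymbol_of_nonpos]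
    positivity
  set l := r⁻¹ - 1 with hl
  have hl0 : 0 ≤ l := sub_nonneg.2 ((one_le_inv₀ h0).2 hr.2)
  have e1 : heatSymbol (t + h) r - heatSymbol t r - h * (heatSymbol t r - heatQuotient t r) =
      Real.exp (-t * l) * (Real.exp (-h * l) - 1 - (-h * l)) := by
    rw [heatQuotient, heatSymbol_of_pos _ h0, heatSymbol_of_pos _ h0, ← hl,
      show -(t + h) * l = -t * l + -h * l by ring, Real.exp_add]
    rw [show r⁻¹ = l + 1 by rw [hl]; ring]
    ring
  rw [e1, abs_mul, abs_of_pos (Real.exp_pos _)]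
  have h3 : (t / 2 * l) ^ 2 / 2 ≤ Real.exp (t / 2 * l) := by
    have := Real.quadratic_le_exp_of_nonneg (x := t / 2 * l) (by positivity)
    have : 0 ≤ t / 2 * l := by positivity
    linarith
  have h4 : |-h * l| ≤ t / 2 * l := by
    rw [abs_mul, abs_neg, abs_of_nonneg hl0]
    gcongr
  calc Real.exp (-t * l) * |Real.exp (-h * l) - 1 - (-h * l)|
      ≤ Real.exp (-t * l) * ((-h * l) ^ 2 * Real.exp (t / 2 * l)) := by
        gcongr
        exact (abs_exp_sub_one_sub_le _).trans (by gcongr)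
    _ = h ^ 2 * (l ^ 2 * Real.exp (-(t / 2 * l))) := by
        rw [show -t * l = -(t / 2 * l) + -(t / 2 * l) by ring, Real.exp_add,
          Real.exp_neg (t / 2 * l)]
        field_simp
    _ ≤ h ^ 2 * (8 / t ^ 2) := by
        gcongr
        rw [Real.exp_neg, ← div_eq_mul_inv, div_le_iff₀ (Real.exp_pos _)]
        calc l ^ 2 = 8 / t ^ 2 * ((t / 2 * l) ^ 2 / 2) := by field_simp; ring
          _ ≤ _ := by gcongr
    _ = _ := mul_comm _ _

theorem hasDerivAt_expOfResolvent (hJ : IsSelfAdjoint J) (hs : spectrum ℝ J ⊆ Icc 0 1)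
    {t : ℝ} (ht : 0 < t) (u : H) :
    HasDerivAt (fun s => expOfResolvent J s u)
      (J (cfc (heatQuotient t) J u) - cfc (heatQuotient t) J u) t := by
  rw [hasDerivAt_iff_isLittleO_nhds_zero]
  have hO : (fun h : ℝ => expOfResolvent J (t + h) u - expOfResolvent J t u -
      h • (J (cfc (heatQuotient t) J u) - cfc (heatQuotient t) J u)) =O[𝓝 0]
      fun h => h ^ 2 := by
    refine Asymptotics.IsBigO.of_bound (8 / t ^ 2 * ‖u‖) ?_
    have : Icc (-(t / 2)) (t / 2) ∈ 𝓝 (0 : ℝ) := Icc_mem_nhds (by linarith) (by linarith)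
    filter_upwards [this] with h hh
    have hh' : |h| ≤ t / 2 := abs_le.2 hh
    have c1 := (continuous_heatSymbol (show 0 < t + h by linarith [hh.1])).continuousOn
      (s := spectrum ℝ J)
    have c2 := (continuous_heatSymbol ht).continuousOn (s := spectrum ℝ J)
    have c3 := (continuous_heatQuotient ht).continuousOn (s := spectrum ℝ J)
    have e : expOfResolvent J (t + h) u - expOfResolvent J t u -
        h • (J (cfc (heatQuotient t) J u) - cfc (heatQuotient t) J u) =
        cfc (fun r => heatSymbol (t + h) r - heatSymbol t r -
          h * (heatSymbol t r - heatQuotient t r)) J u := by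
      rw [← functionalCalculus, ← expOfResolvent_apply_eq hJ hs ht, functionalCalculus]
      rw [cfc_sub (fun r => heatSymbol (t + h) r - heatSymbol t r)
          (fun r => h * (heatSymbol t r - heatQuotient t r)) J (c1.sub c2)
          ((c2.sub c3).const_mul h |>.congr fun _ _ => rfl),
        cfc_sub _ _ J c1 c2, cfc_const_mul h (fun r => heatSymbol t r - heatQuotient t r) J (c2.sub c3), cfc_sub _ _ J c2 c3]
      rfl
    rw [e, Real.norm_of_nonneg (sq_nonneg h)]
    refine (norm_cfc_apply_le hs (by positivity)
      (fun r hr => abs_heatSymbol_taylor ht hh' hr) u).trans_eq (by ring)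
  exact hO.trans_isLittleO (Asymptotics.isLittleO_pow_id one_lt_two)

/-- On the range of `J` the convergence has rate `t`, since `(1 - e^{-tλ}) / (1 + λ) ≤ t`. That
range is dense, `J` being self-adjoint and injective, and the `P_t` are contractions. -/
theorem tendsto_expOfResolvent_zero (hJ : IsSelfAdjoint J) (hs : spectrum ℝ J ⊆ Icc 0 1)
    (hinj : Function.Injective J) (u : H) :
    Tendsto (fun t => expOfResolvent J t u) (𝓝[>] 0) (𝓝 u) := by
  have hdense : DenseRange J := by
    have h := ContinuousLinearMap.orthogonal_range J
    rw [hJ.adjoint_eq, LinearMap.ker_eq_bot.2 hinj] at h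
    have := Submodule.topologicalClosure_eq_top_iff.2 h
    exact Submodule.dense_iff_topologicalClosure_eq_top.2 this
  have hrange : ∀ t > 0, ∀ b : H, ‖expOfResolvent J t (J b) - J b‖ ≤ t * ‖b‖ := by
    intro t ht b
    have c2 := (continuous_heatSymbol ht).continuousOn (s := spectrum ℝ J)
    have e : expOfResolvent J t (J b) - J b = cfc (fun r => heatSymbol t r * r - r) J b := by
      rw [cfc_sub (fun r => heatSymbol t r * r) (fun r => r) J (c2.mul continuousOn_id)
        continuousOn_id, cfc_mul (heatSymbol t) (fun r => r) J c2 continuousOn_id, cfc_id' ℝ J]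
      rfl
    rw [e]
    refine norm_cfc_apply_le hs ht.le (fun r hr => ?_) b
    rcases eq_or_lt_of_le hr.1 with rfl | h0
    · simpa using ht.le
    · have h1 := heatSymbol_le_one ht.le hr.2
      have h2 : 1 - t * (r⁻¹ - 1) ≤ heatSymbol t r := by
        rw [heatSymbol_of_pos t h0]
        linarith [Real.add_one_le_exp (-t * (r⁻¹ - 1))]
      have h3 : (1 - t * (r⁻¹ - 1)) * r ≤ heatSymbol t r * r := by gcongr
      have h4 : (1 - t * (r⁻¹ - 1)) * r = r - t * (1 - r) := by field_simp
      have h5 : heatSymbol t r * r ≤ 1 * r := by gcongr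
      rw [abs_le]
      constructor <;> nlinarith
  rw [Metric.tendsto_nhdsWithin_nhds]
  intro ε hε
  obtain ⟨b, hb⟩ := hdense.exists_dist_lt u (show 0 < ε / 3 by positivity)
  rw [dist_eq_norm] at hb
  refine ⟨ε / (3 * (‖b‖ + 1)), by positivity, fun {t} ht hd => ?_⟩
  have ht0 : 0 < t := ht
  rw [Real.dist_eq, sub_zero, abs_of_pos ht0, lt_div_iff₀ (by positivity)] at hd
  rw [dist_eq_norm]
  have e : expOfResolvent J t u - u = expOfResolvent J t (u - J b) +
      (expOfResolvent J t (J b) - J b) - (u - J b) := by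
    rw [map_sub]; abel
  have h1 := norm_expOfResolvent_apply_le hs ht0 (u - J b)
  have h2 := hrange t ht0 b
  rw [e]
  have h3 := norm_sub_le (expOfResolvent J t (u - J b) + (expOfResolvent J t (J b) - J b)) (u - J b)
  have h4 := norm_add_le (expOfResolvent J t (u - J b)) (expOfResolvent J t (J b) - J b)
  nlinarith

/-- Chain rule along the semigroup for a function with a quadratic error bound. -/
theorem hasDerivAt_comp_expOfResolvent (hJ : IsSelfAdjoint J) (hs : spectrum ℝ J ⊆ Icc 0 1)
    {t : ℝ} (ht : 0 < t) (u : H) {g : H → ℝ} {e : H} {B : ℝ}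
    (hg : ∀ v, |g v - g (expOfResolvent J t u) - (inner ℂ e (v - expOfResolvent J t u)).re| ≤
      B * ‖v - expOfResolvent J t u‖ ^ 2) :
    HasDerivAt (fun s => g (expOfResolvent J s u))
      (inner ℂ e (J (functionalCalculus (heatQuotient t) J u) - functionalCalculus (heatQuotient t) J u)).re t := by
  have hd := hasDerivAt_expOfResolvent hJ hs ht u
  have h1 : HasDerivAt (fun s => (inner ℂ e (expOfResolvent J s u)).re)
      (inner ℂ e (J (functionalCalculus (heatQuotient t) J u) - functionalCalculus (heatQuotient t) J u)).re t :=
    (Complex.reCLM ∘L (innerSL ℂ e).restrictScalars ℝ).hasFDerivAt.comp_hasDerivAt t hd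
  rw [hasDerivAt_iff_isLittleO] at h1 ⊢
  have h2 : (fun s => g (expOfResolvent J s u) - g (expOfResolvent J t u) -
      (inner ℂ e (expOfResolvent J s u - expOfResolvent J t u)).re) =o[𝓝 t] fun s => s - t := by
    have h3 : (fun s => g (expOfResolvent J s u) - g (expOfResolvent J t u) -
        (inner ℂ e (expOfResolvent J s u - expOfResolvent J t u)).re) =O[𝓝 t]
        fun s => ‖expOfResolvent J s u - expOfResolvent J t u‖ ^ 2 := by
      refine Asymptotics.IsBigO.of_bound B (Eventually.of_forall fun s => ?_)
      rw [Real.norm_eq_abs, Real.norm_of_nonneg (sq_nonneg _)]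
      exact hg _
    have h4 : (fun s => ‖expOfResolvent J s u - expOfResolvent J t u‖ ^ 2) =O[𝓝 t]
        fun s => (s - t) ^ 2 := hd.isBigO_sub.norm_left.pow 2
    refine (h3.trans h4).trans_isLittleO ?_
    have h5 := (Asymptotics.isLittleO_pow_id (𝕜 := ℝ) one_lt_two).comp_tendsto
      (k := fun s : ℝ => s - t) (l' := 𝓝 t) (by
        have : Continuous fun s : ℝ => s - t := by fun_prop
        simpa using this.tendsto t)
    exact h5
  refine (h1.add h2).congr_left fun s => ?_
  rw [inner_sub_right e (expOfResolvent J s u), Complex.sub_re]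
  ring

end Semigroup

/-! ### Lower bound for the decay in terms of the energy -/

section LogConvexity

variable {H G : Type*} [NormedAddCommGroup H] [InnerProductSpace ℂ H] [CompleteSpace H]
  [NormedAddCommGroup G] [InnerProductSpace ℂ G] [CompleteSpace G]
  (K : Submodule ℂ (WithLp 2 (H × G))) [K.HasOrthogonalProjection]

/-- The Yosida-type truncation of `1 + λ` is dominated by the form. -/
theorem re_inner_cfc_inv_max_le {k : WithLp 2 (H × G)} (hk : k ∈ K) {ε : ℝ} (hε : 0 < ε) :
    (inner ℂ (cfc (fun r => (max r ε)⁻¹) (graphResolvent K) k.fst) k.fst).re ≤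
      ‖k.fst‖ ^ 2 + ‖k.snd‖ ^ 2 := by
  have hJ := isSelfAdjoint_graphResolvent K
  have hs := spectrum_graphResolvent K
  have hc : Continuous fun r : ℝ => (max r ε)⁻¹ :=
    (continuous_id.max continuous_const).inv₀ fun r => (lt_max_of_lt_right hε).ne'
  -- Testing with `a = max(J, ε)⁻¹ k.fst` gives `2x - y` on the left, where `y ≤ x` because `r /
  -- max(r, ε)² ≤ 1 / max(r, ε)`.
  refine le_trans ?_ (sub_le_norm_sq_of_mem K hk (cfc (fun r => (max r ε)⁻¹) (graphResolvent K) k.fst))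
  rw [apply_cfc_apply hJ hs hc.continuousOn, ← inner_cfc_left, ← inner_cfc_left]
  have e : cfc (fun r => (max r ε)⁻¹) (graphResolvent K)
      (cfc (fun r => r * (max r ε)⁻¹) (graphResolvent K) k.fst) =
      cfc (fun r => (max r ε)⁻¹ * (r * (max r ε)⁻¹)) (graphResolvent K) k.fst := by
    rw [cfc_mul (fun r => (max r ε)⁻¹) (fun r => r * (max r ε)⁻¹) (graphResolvent K)
      hc.continuousOn (continuous_id.mul hc).continuousOn]
    rfl
  rw [e]
  have := re_inner_cfc_mono hs (f := fun r => (max r ε)⁻¹ * (r * (max r ε)⁻¹))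
    (g := fun r => (max r ε)⁻¹) (hc.mul (continuous_id.mul hc)).continuousOn hc.continuousOn
    (fun r hr => by
      have h0 : 0 < max r ε := lt_max_of_lt_right hε
      have h1 : r * (max r ε)⁻¹ ≤ 1 := by
        rw [← div_eq_mul_inv, div_le_one h0]; exact le_max_left _ _
      exact mul_le_of_le_one_right (by positivity) h1) k.fst
  linarith

theorem re_inner_real_smul_left (a : ℝ) (x y : H) :
    (inner ℂ (a • x) y).re = a * (inner ℂ x y).re := by
  rw [← Complex.coe_smul, inner_smul_left]
  simp

/-- Jensen's inequality for the spectral measure: `‖e^{-tA} f‖² ≥ ‖f‖² exp(-2t ℰ(f) / ‖f‖²)`. -/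
theorem norm_sq_mul_exp_le {k : WithLp 2 (H × G)} (hk : k ∈ K) (h0 : k.fst ≠ 0) {t : ℝ}
    (ht : 0 < t) :
    ‖k.fst‖ ^ 2 * Real.exp (-(2 * t * (‖k.snd‖ ^ 2 / ‖k.fst‖ ^ 2))) ≤
      ‖expOfResolvent (graphResolvent K) t k.fst‖ ^ 2 := by
  have hs := spectrum_graphResolvent K
  set g := k.fst
  set l := ‖k.snd‖ ^ 2 / ‖g‖ ^ 2 with hl
  have hg : 0 < ‖g‖ ^ 2 := by positivity
  have key : ∀ ε > 0, ‖g‖ ^ 2 * Real.exp (-(2 * t * l)) ≤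
      ‖expOfResolvent (graphResolvent K) t g‖ ^ 2 + heatSymbol (2 * t) ε * ‖g‖ ^ 2 := by
    intro ε hε
    have hc : Continuous fun r : ℝ => (max r ε)⁻¹ :=
      (continuous_id.max continuous_const).inv₀ fun r => (lt_max_of_lt_right hε).ne'
    have hh := continuous_heatSymbol (show 0 < 2 * t by positivity)
    -- Up to the last term of `a`, the function `a - b (1 + λ)` is the tangent of `e^{-2tλ}` at the
    -- mean energy `λ = l`. Replacing `1 + λ` by `max(r, ε)⁻¹` keeps the symbol continuous at `r =
    -- 0`; subtracting `heatSymbol (2t) ε` keeps it below the heat symbol for `r < ε`.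
    set a := Real.exp (-(2 * t * l)) * (1 + 2 * t * l + 2 * t) - heatSymbol (2 * t) ε with ha
    set b := Real.exp (-(2 * t * l)) * (2 * t) with hb
    have h1 := re_inner_cfc_mono hs (f := fun r => a - b * (max r ε)⁻¹)
      (g := heatSymbol (2 * t)) (continuous_const.sub (continuous_const.mul hc)).continuousOn
      hh.continuousOn (fun r hr => by
        have h2 : Real.exp (-(2 * t * l)) * (1 + 2 * t * l + 2 * t) - b * (max r ε)⁻¹ ≤
            Real.exp (-(2 * t) * ((max r ε)⁻¹ - 1)) := by
          have := Real.add_one_le_exp (2 * t * l - 2 * t * ((max r ε)⁻¹ - 1))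
          rw [show -(2 * t) * ((max r ε)⁻¹ - 1) =
            -(2 * t * l) + (2 * t * l - 2 * t * ((max r ε)⁻¹ - 1)) by ring, Real.exp_add, hb]
          nlinarith [Real.exp_pos (-(2 * t * l))]
        rcases le_total r ε with hrε | hrε
        · rw [max_eq_right hrε] at h2 ⊢
          rw [← heatSymbol_of_pos _ hε] at h2
          linarith [heatSymbol_nonneg (2 * t) r]
        · rw [max_eq_left hrε] at h2 ⊢
          rw [← heatSymbol_of_pos _ (hε.trans_le hrε)] at h2
          linarith [heatSymbol_nonneg (2 * t) ε]) g
    have e : cfc (fun r => a - b * (max r ε)⁻¹) (graphResolvent K) g =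
        a • g - b • cfc (fun r => (max r ε)⁻¹) (graphResolvent K) g := by
      rw [cfc_sub (fun _ => a) (fun r => b * (max r ε)⁻¹) (graphResolvent K) continuousOn_const
        (continuous_const.mul hc).continuousOn,
        cfc_const_mul b _ (graphResolvent K) hc.continuousOn,
        cfc_const a (graphResolvent K) (isSelfAdjoint_graphResolvent K), Algebra.algebraMap_eq_smul_one]
      rfl
    have hgg : (inner ℂ g g).re = ‖g‖ ^ 2 := inner_self_eq_norm_sq (𝕜 := ℂ) g
    rw [e, ← norm_sq_expOfResolvent_apply hs ht, inner_sub_left, Complex.sub_re,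
      re_inner_real_smul_left, re_inner_real_smul_left, hgg] at h1
    have h3 := re_inner_cfc_inv_max_le K hk hε
    have hb0 : 0 ≤ b := by positivity
    have h4 := mul_le_mul_of_nonneg_left h3 hb0
    have h5 : ‖k.snd‖ ^ 2 = l * ‖g‖ ^ 2 := by rw [hl]; field_simp
    have h6 : a * ‖g‖ ^ 2 - b * (‖g‖ ^ 2 + ‖k.snd‖ ^ 2) =
        ‖g‖ ^ 2 * Real.exp (-(2 * t * l)) - heatSymbol (2 * t) ε * ‖g‖ ^ 2 := by
      rw [h5, ha, hb]; ring
    linarith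
  have hlim : Tendsto (fun ε => ‖expOfResolvent (graphResolvent K) t g‖ ^ 2 +
      heatSymbol (2 * t) ε * ‖g‖ ^ 2) (𝓝[>] 0)
      (𝓝 (‖expOfResolvent (graphResolvent K) t g‖ ^ 2)) := by
    have hc : Continuous fun ε => ‖expOfResolvent (graphResolvent K) t g‖ ^ 2 +
        heatSymbol (2 * t) ε * ‖g‖ ^ 2 :=
      continuous_const.add ((continuous_heatSymbol (by positivity)).mul continuous_const)
    have := hc.tendsto 0
    rw [heatSymbol_of_nonpos _ le_rfl, zero_mul, add_zero] at this
    exact this.mono_left nhdsWithin_le_nhds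
  refine ge_of_tendsto hlim ?_
  filter_upwards [self_mem_nhdsWithin] with ε hε using key ε hε

end LogConvexity

/-! ### N-functions and their conjugates -/

section NFunction

variable {Φ Ψ ψ : ℝ → ℝ}

theorem IsNFunction.map_zero (hΦ : IsNFunction Φ) : Φ 0 = 0 := (hΦ.eq_zero_iff 0).2 rfl

theorem IsNFunction.map_mul_le (hΦ : IsNFunction Φ) {a : ℝ} (ha : 0 ≤ a) (ha1 : a ≤ 1) (x : ℝ) :
    Φ (a * x) ≤ a * Φ x := by
  have := hΦ.convexOn.2 (mem_univ x) (mem_univ 0) ha (sub_nonneg.2 ha1) (by ring)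
  simpa [hΦ.map_zero] using this

theorem IsNFunction.map_abs (hΦ : IsNFunction Φ) (x : ℝ) : Φ |x| = Φ x := by
  rcases abs_choice x with h | h <;> rw [h]
  exact hΦ.even x

theorem IsNFunction.monotoneOn (hΦ : IsNFunction Φ) : MonotoneOn Φ (Ici 0) := by
  intro x hx y hy hxy
  rcases eq_or_lt_of_le (mem_Ici.1 hy) with h | h
  · rw [le_antisymm hxy (h ▸ mem_Ici.1 hx)]
  · have h1 : x / y ≤ 1 := (div_le_one h).2 hxy
    have := hΦ.map_mul_le (div_nonneg hx hy) h1 y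
    rw [div_mul_cancel₀ _ h.ne'] at this
    exact this.trans (mul_le_of_le_one_left (hΦ.nonneg y) h1)

theorem IsNFunction.map_le_of_abs_le (hΦ : IsNFunction Φ) {x y : ℝ} (h : |x| ≤ |y|) :
    Φ x ≤ Φ y := by
  rw [← hΦ.map_abs x, ← hΦ.map_abs y]
  exact hΦ.monotoneOn (abs_nonneg x) (abs_nonneg y) h

theorem IsNFunction.bddAbove_conjugate (hΦ : IsNFunction Φ) (y : ℝ) :
    BddAbove ((fun x => x * |y| - Φ x) '' Ici 0) := by
  obtain ⟨R, hR⟩ := eventually_atTop.1 (hΦ.superlinear.eventually_ge_atTop |y|)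
  refine ⟨max R 1 * |y|, ?_⟩
  rintro _ ⟨x, hx, rfl⟩
  rcases le_total x (max R 1) with h | h
  · have : x * |y| ≤ max R 1 * |y| := by gcongr
    linarith [hΦ.nonneg x]
  · have hx0 : 0 < x := lt_of_lt_of_le (by positivity) h
    have h1 := hR x ((le_max_left _ _).trans h)
    rw [le_div_iff₀ hx0] at h1
    have : 0 ≤ max R 1 * |y| := by positivity
    dsimp only
    linarith

theorem IsNFunction.le_conjugate (hΦ : IsNFunction Φ) {x : ℝ} (hx : 0 ≤ x) (y : ℝ) :
    x * |y| - Φ x ≤ conjugate Φ y :=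
  le_csSup (hΦ.bddAbove_conjugate y) ⟨x, hx, rfl⟩

theorem IsNFunction.conjugate_le {y c : ℝ} (h : ∀ x, 0 ≤ x → x * |y| - Φ x ≤ c) :
    conjugate Φ y ≤ c := by
  refine csSup_le (nonempty_Ici.image _) ?_
  rintro _ ⟨x, hx, rfl⟩
  exact h x hx

/-- A supremum of functions convex in `y`, because `x ≥ 0`. Convexity supplies the continuity needed
for surjectivity. -/
theorem IsNFunction.convexOn_conjugate (hΦ : IsNFunction Φ) :
    ConvexOn ℝ univ (conjugate Φ) := by
  refine ⟨convex_univ, fun y _ z _ a b ha hb hab => conjugate_le fun x hx => ?_⟩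
  have h1 := mul_le_mul_of_nonneg_left (hΦ.le_conjugate hx y) ha
  have h2 := mul_le_mul_of_nonneg_left (hΦ.le_conjugate hx z) hb
  have h3 : |a • y + b • z| ≤ a * |y| + b * |z| := by
    refine (abs_add_le _ _).trans_eq ?_
    rw [smul_eq_mul, smul_eq_mul, abs_mul, abs_mul, abs_of_nonneg ha, abs_of_nonneg hb]
  have h4 := mul_le_mul_of_nonneg_left h3 hx
  have h5 : Φ x = a * Φ x + b * Φ x := by rw [← add_mul, hab, one_mul]
  simp only [smul_eq_mul] at *
  linarith

theorem IsNFunction.monotoneOn_conjugate (hΦ : IsNFunction Φ) :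
    MonotoneOn (conjugate Φ) (Ici 0) := by
  intro y hy z hz hyz
  refine conjugate_le fun x hx => le_trans ?_ (hΦ.le_conjugate hx z)
  rw [abs_of_nonneg (mem_Ici.1 hy), abs_of_nonneg (mem_Ici.1 hz)]
  gcongr

theorem IsNFunction.surjOn_conjugate (hΦ : IsNFunction Φ) :
    SurjOn (conjugate Φ) (Ici 0) (Ici 0) := by
  intro y hy
  have hy0 : 0 ≤ y := hy
  have h0 : conjugate Φ 0 ≤ 0 := conjugate_le fun x _ => by simpa using hΦ.nonneg x
  -- The point `y + Φ 1` comes from testing the supremum at `x = 1`.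
  have h1 : y ≤ conjugate Φ (y + Φ 1) := by
    have := hΦ.le_conjugate zero_le_one (y + Φ 1)
    rw [abs_of_nonneg (add_nonneg hy0 (hΦ.nonneg 1))] at this
    linarith
  have hc : ContinuousOn (conjugate Φ) (Icc 0 (y + Φ 1)) :=
    hΦ.convexOn_conjugate.locallyLipschitz.continuous.continuousOn
  obtain ⟨z, hz, hzy⟩ := intermediate_value_Icc (add_nonneg hy0 (hΦ.nonneg 1)) hc
    ⟨h0.trans hy0, h1⟩
  exact ⟨z, hz.1, hzy⟩

theorem mapsTo_invNonneg {g : ℝ → ℝ} (hg : SurjOn g (Ici 0) (Ici 0)) :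
    MapsTo (invNonneg g) (Ici 0) (Ici 0) :=
  fun _ hy => Function.invFunOn_mem (hg hy)

/-- Any right inverse of a nondecreasing surjection is nondecreasing, whichever preimages are
chosen; injectivity of `g` is not needed. -/
theorem monotoneOn_invNonneg {g : ℝ → ℝ} (hmono : MonotoneOn g (Ici 0))
    (hg : SurjOn g (Ici 0) (Ici 0)) : MonotoneOn (invNonneg g) (Ici 0) := by
  intro y hy z hz hyz
  rcases eq_or_lt_of_le hyz with rfl | hlt
  · exact le_rfl
  · by_contra! h
    have := hmono (mapsTo_invNonneg hg hz) (mapsTo_invNonneg hg hy) h.le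
    rw [invNonneg, Function.invFunOn_eq (hg hy), Function.invFunOn_eq (hg hz)] at this
    linarith

theorem surjOn_Ici_of_tendsto (hψ_cont : ContinuousOn ψ (Ici 0)) (hψ_zero : ψ 0 = 0)
    (hψ_top : Tendsto ψ atTop atTop) : SurjOn ψ (Ici 0) (Ici 0) := by
  intro y hy
  obtain ⟨R, hR⟩ := eventually_atTop.1 (hψ_top.eventually_ge_atTop y)
  obtain ⟨z, hz, hzy⟩ := intermediate_value_Icc (le_max_right R 0)
    (hψ_cont.mono fun x hx => hx.1) ⟨hψ_zero.trans_le hy, hR _ (le_max_left _ _)⟩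
  exact ⟨z, hz.1, hzy⟩

/-- Near `0` by continuity of `Ψ`, and elsewhere because `ψ` is bounded below. The constant `1/2`
leaves room for the quadratic term to contribute the other half of `∫ Ψ(f / l) dμ ≤ 1` on a
probability space. -/
theorem exists_quotientFunction_le (hΨ : IsNFunction (quotientFunction ψ))
    (hψ_mono : StrictMonoOn ψ (Ici 0)) (hψ_zero : ψ 0 = 0) :
    ∃ B > 0, ∀ x, quotientFunction ψ x ≤ 1 / 2 + B * x ^ 2 := by
  have h := hΨ.continuous.tendsto 0
  rw [hΨ.map_zero] at h
  obtain ⟨δ, hδ, hδ'⟩ := Metric.eventually_nhds_iff.1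
    (h.eventually (gt_mem_nhds (show (0 : ℝ) < 1 / 2 by norm_num)))
  have hpos : 0 < ψ (δ / 2) := by
    rw [← hψ_zero]
    exact hψ_mono (mem_Ici.2 le_rfl) (mem_Ici.2 (by positivity)) (by positivity)
  refine ⟨(ψ (δ / 2))⁻¹, by positivity, fun x => ?_⟩
  rcases lt_or_ge |x| δ with hx | hx
  · have := hδ' (y := x) (by simpa using hx)
    have : 0 ≤ (ψ (δ / 2))⁻¹ * x ^ 2 := by positivity
    linarith
  · have h1 : ψ (δ / 2) ≤ ψ |x| :=
      hψ_mono.monotoneOn (mem_Ici.2 (by positivity)) (abs_nonneg x) (by linarith)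
    have h2 : quotientFunction ψ x ≤ (ψ (δ / 2))⁻¹ * x ^ 2 := by
      rw [quotientFunction, div_eq_inv_mul]
      gcongr
    linarith

end NFunction

/-! ### The function `θ` and the two one-variable arguments -/

section Rate

variable {m : ℝ → ℝ}

theorem invPos_mem (hm_bij : BijOn m (Ioi 0) (Ioi 0)) {y : ℝ} (hy : 0 < y) : 0 < invPos m y :=
  Function.invFunOn_mem (hm_bij.surjOn hy)

theorem apply_invPos (hm_bij : BijOn m (Ioi 0) (Ioi 0)) {y : ℝ} (hy : 0 < y) :
    m (invPos m y) = y :=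
  Function.invFunOn_eq (hm_bij.surjOn hy)

theorem strictAntiOn_invPos (hm_anti : StrictAntiOn m (Ioi 0)) (hm_bij : BijOn m (Ioi 0) (Ioi 0)) :
    StrictAntiOn (invPos m) (Ioi 0) := by
  intro y hy z hz hyz
  by_contra! h
  have := hm_anti.antitoneOn (invPos_mem hm_bij hy) (invPos_mem hm_bij hz) h
  rw [apply_invPos hm_bij hy, apply_invPos hm_bij hz] at this
  linarith

theorem continuousAt_invPos (hm_anti : StrictAntiOn m (Ioi 0)) (hm_bij : BijOn m (Ioi 0) (Ioi 0))
    {y : ℝ} (hy : 0 < y) : ContinuousAt (invPos m) y := by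
  have h1 : StrictMonoOn (fun y => -invPos m y) (Ioi 0) := (strictAntiOn_invPos hm_anti hm_bij).neg
  have h2 : ContinuousAt (fun y => -invPos m y) y := by
    refine h1.continuousAt_of_image_mem_nhds (Ioi_mem_nhds hy) ?_
    have : Iio (0 : ℝ) ∈ 𝓝 (-invPos m y) := Iio_mem_nhds (neg_neg_of_pos (invPos_mem hm_bij hy))
    refine mem_of_superset this fun z hz => ?_
    have hz' : 0 < -z := neg_pos.2 hz
    refine ⟨m (-z), hm_bij.mapsTo hz', ?_⟩
    have : invPos m (m (-z)) = -z :=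
      hm_bij.injOn (invPos_mem hm_bij (hm_bij.mapsTo hz')) hz'
        (apply_invPos hm_bij (hm_bij.mapsTo hz'))
    simp [this]
  exact h2.neg.congr (Eventually.of_forall fun z => neg_neg _)

theorem hasDerivAt_of_mem (hm_smooth : ContDiffOn ℝ 1 m (Ioi 0)) {t : ℝ} (ht : 0 < t) :
    HasDerivAt m (deriv m t) t :=
  ((hm_smooth.differentiableOn one_ne_zero).differentiableAt (Ioi_mem_nhds ht)).hasDerivAt

theorem hasDerivAt_invPos (hm_smooth : ContDiffOn ℝ 1 m (Ioi 0)) (hm_anti : StrictAntiOn m (Ioi 0))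
    (hm_bij : BijOn m (Ioi 0) (Ioi 0)) (hm'_bij : BijOn (deriv m) (Ioi 0) (Iio 0))
    {y : ℝ} (hy : 0 < y) : HasDerivAt (invPos m) (deriv m (invPos m y))⁻¹ y := by
  refine (hasDerivAt_of_mem hm_smooth (invPos_mem hm_bij hy)).of_local_left_inverse
    (continuousAt_invPos hm_anti hm_bij hy)
    (ne_of_lt (hm'_bij.mapsTo (invPos_mem hm_bij hy))) ?_
  filter_upwards [Ioi_mem_nhds hy] with z hz using apply_invPos hm_bij hz

theorem continuousAt_rate (hm_smooth : ContDiffOn ℝ 1 m (Ioi 0)) (hm_anti : StrictAntiOn m (Ioi 0))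
    (hm_bij : BijOn m (Ioi 0) (Ioi 0)) {x : ℝ} (hx : 0 < x) : ContinuousAt (rate m) x := by
  have hx2 : 0 < 2 * x := by positivity
  have h1 : ContinuousAt (fun x => invPos m (2 * x)) x :=
    ContinuousAt.comp (f := fun x => 2 * x) (continuousAt_invPos hm_anti hm_bij hx2) (by fun_prop)
  have h2 : ContinuousAt (deriv m) (invPos m (2 * x)) :=
    (hm_smooth.continuousOn_deriv_of_isOpen isOpen_Ioi le_rfl).continuousAt
      (Ioi_mem_nhds (invPos_mem hm_bij hx2))
  exact ((ContinuousAt.comp (f := fun x => invPos m (2 * x)) h2 h1).neg).div continuousAt_id hx.ne'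

/-- The `1/2` of the Nash inequality cancels the `2` inside `θ`. Both implications use the
inequality in this form, with `A` the squared Luxemburg norm. -/
theorem mul_rate_eq {v A : ℝ} (hv : 0 < v) (hA : 0 < A) :
    v * rate m (1 / 2 * (v / A)) = -2 * A * deriv m (invPos m (v / A)) := by
  rw [rate, show 2 * (1 / 2 * (v / A)) = v / A by ring]
  field_simp

/-- A composition of three nondecreasing functions. This is the role of `Φ` and of the factorization
of `θ`. -/
theorem monotoneOn_rate {Φ ψ : ℝ → ℝ} (hΦ : IsNFunction Φ)
    (hΨ : IsNFunction (quotientFunction ψ)) (hψ_cont : ContinuousOn ψ (Ici 0))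
    (hψ_mono : StrictMonoOn ψ (Ici 0)) (hψ_zero : ψ 0 = 0) (hψ_top : Tendsto ψ atTop atTop)
    (hθ : ∀ x > 0, rate m x =
      invNonneg (conjugate Φ) (quotientFunction ψ (invNonneg ψ x))) :
    MonotoneOn (rate m) (Ioi 0) := by
  intro x hx y hy hxy
  have hx0 : 0 < x := hx
  have hy0 : 0 < y := hy
  have hs := surjOn_Ici_of_tendsto hψ_cont hψ_zero hψ_top
  rw [hθ x hx, hθ y hy]
  refine monotoneOn_invNonneg hΦ.monotoneOn_conjugate hΦ.surjOn_conjugate (hΨ.nonneg _)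
    (hΨ.nonneg _) ?_
  exact hΨ.monotoneOn (mapsTo_invNonneg hs hx0.le) (mapsTo_invNonneg hs hy0.le)
    (monotoneOn_invNonneg hψ_mono.monotoneOn hs hx0.le hy0.le hxy)

/-- The differential inequality behind the decay of the variance. -/
theorem le_mul_of_rate_le (hm_smooth : ContDiffOn ℝ 1 m (Ioi 0))
    (hm_anti : StrictAntiOn m (Ioi 0)) (hm_bij : BijOn m (Ioi 0) (Ioi 0))
    (hm'_bij : BijOn (deriv m) (Ioi 0) (Iio 0)) {u u' : ℝ → ℝ} {A t : ℝ} (hA : 0 < A) (ht : 0 < t)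
    (hu : ∀ s > 0, HasDerivAt u (u' s) s) (hpos : ∀ s ∈ Ioc 0 t, 0 < u s)
    (hrate : ∀ s ∈ Ioc 0 t, u s * rate m (1 / 2 * (u s / A)) ≤ -u' s) :
    u t ≤ m t * A := by
  -- In the clock `σ`, defined by `u = A m(σ)`, the differential inequality reads `σ' ≥ 2`, the sign
  -- turning because `m' < 0`.
  set σ : ℝ → ℝ := fun s => invPos m (u s / A) with hσ
  have hσ' : ∀ s ∈ Ioc 0 t, HasDerivAt σ ((deriv m (σ s))⁻¹ * (u' s / A)) s := fun s hs =>
    HasDerivAt.comp s (hasDerivAt_invPos hm_smooth hm_anti hm_bij hm'_bij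
      (div_pos (hpos s hs) hA)) ((hu s hs.1).div_const A)
  have hge : ∀ s ∈ Ioc 0 t, 2 ≤ (deriv m (σ s))⁻¹ * (u' s / A) := by
    intro s hs
    have hneg : deriv m (σ s) < 0 := hm'_bij.mapsTo (invPos_mem hm_bij (div_pos (hpos s hs) hA))
    have h := hrate s hs
    rw [mul_rate_eq (hpos s hs) hA] at h
    rw [inv_mul_eq_div, le_div_iff_of_neg hneg, div_le_iff₀ hA]
    linarith
  -- At speed `2` the interval `[t/2, t]` already gains `t`, so `σ(t/2) > 0` suffices and the
  -- behaviour of `u` near time `0` plays no part.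
  have hsub : Icc (t / 2) t ⊆ Ioc 0 t := fun s hs => ⟨by linarith [hs.1], hs.2⟩
  have key := (convex_Icc (t / 2) t).mul_sub_le_image_sub_of_le_deriv (f := σ) (C := 2)
    (fun s hs => (hσ' s (hsub hs)).continuousAt.continuousWithinAt)
    (fun s hs => (hσ' s (hsub (interior_subset hs))).differentiableAt.differentiableWithinAt)
    (fun s hs => by
      rw [(hσ' s (hsub (interior_subset hs))).deriv]
      exact hge s (hsub (interior_subset hs)))
    (t / 2) (left_mem_Icc.2 (by linarith)) t (right_mem_Icc.2 (by linarith)) (by linarith)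
  have h1 : 0 < σ (t / 2) := invPos_mem hm_bij (div_pos (hpos _ ⟨by linarith, by linarith⟩) hA)
  have h2 : t ≤ σ t := by linarith
  have h3 := hm_anti.antitoneOn (mem_Ioi.2 ht) (mem_Ioi.2 (ht.trans_le h2)) h2
  rw [apply_invPos hm_bij (div_pos (hpos t ⟨ht, le_rfl⟩) hA), div_le_iff₀ hA] at h3
  exact h3

/-- The optimization in time that turns the decay of the variance into a functional inequality. -/
theorem mul_rate_le_of_decay (hm_smooth : ContDiffOn ℝ 1 m (Ioi 0))
    (hm_bij : BijOn m (Ioi 0) (Ioi 0)) {γ : ℝ} (hγ : 0 < γ) (hm_D : ConditionD m γ)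
    {v A e : ℝ} (hv : 0 < v) (hA : 0 < A)
    (h : ∀ t > 0, v * Real.exp (-(2 * t * (e / v))) ≤ m t * A) :
    v * rate m (1 / 2 * (v / A)) ≤ 8 / γ * e := by
  -- At this time `m t * A = v`, so the decay bound says nothing new; the information comes from
  -- time `2t`, and (D) carries the increment of `-log m` back to its slope at `t`.
  set t := invPos m (v / A) with ht_def
  have hvA : 0 < v / A := div_pos hv hA
  have ht : 0 < t := invPos_mem hm_bij hvA
  have hmt : m t = v / A := apply_invPos hm_bij hvA
  have hM : ∀ s > 0, HasDerivAt (fun s => -Real.log (m s)) (-(deriv m s / m s)) s := fun s hs =>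
    ((hasDerivAt_of_mem hm_smooth hs).log (hm_bij.mapsTo hs).ne').neg
  have hmv := (convex_Icc t (2 * t)).mul_sub_le_image_sub_of_le_deriv
    (f := fun s => -Real.log (m s)) (C := γ * -(deriv m t / m t))
    (fun s hs => (hM s (ht.trans_le hs.1)).continuousAt.continuousWithinAt)
    (fun s hs => (hM s (ht.trans_le (interior_subset hs).1)).differentiableAt.differentiableWithinAt)
    (fun s hs => by
      have := hm_D t ht s (interior_subset hs)
      rwa [(hM t ht).deriv] at this)
    t (left_mem_Icc.2 (by linarith)) (2 * t) (right_mem_Icc.2 (by linarith)) (by linarith)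
  have hdecay := h (2 * t) (by positivity)
  have hlog : Real.log (m t) - 2 * (2 * t) * (e / v) ≤ Real.log (m (2 * t)) := by
    rw [← Real.log_exp (2 * (2 * t) * (e / v)), ← Real.log_div (by rw [hmt]; exact hvA.ne')
      (Real.exp_pos _).ne']
    refine Real.log_le_log (div_pos (by rw [hmt]; exact hvA) (Real.exp_pos _)) ?_
    rw [hmt, div_eq_mul_inv, ← Real.exp_neg, div_mul_eq_mul_div, div_le_iff₀ hA]
    exact hdecay
  rw [mul_rate_eq hv hA, ← ht_def]
  rw [hmt] at hmv hlog
  -- The `4` is the exponent `2 · (2t) e / v` at time `2t`; the factor `2` in `mul_rate_eq` turns it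
  -- into `8`.
  have h1 : γ * -(deriv m t / (v / A)) * t ≤ 4 * (e / v) * t := by
    linarith
  have h2 := le_of_mul_le_mul_right h1 ht
  have h3 : γ * -(deriv m t / (v / A)) = γ * (-2 * A * deriv m t) / (2 * v) := by field_simp
  rw [h3, div_le_iff₀ (by positivity)] at h2
  have h4 : 4 * (e / v) * (2 * v) = 8 * e := by field_simp; ring
  rw [h4] at h2
  rw [div_mul_eq_mul_div, le_div_iff₀ hγ]
  linarith

end Rate

/-! ### Luxemburg norms on a probability space -/

section Luxemburg

variable {α : Type*} [MeasurableSpace α] {μ : Measure α} {Ψ : ℝ → ℝ}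

theorem luxemburgNorm_nonneg (Ψ : ℝ → ℝ) (μ : Measure α) (f : α → ℝ) : 0 ≤ luxemburgNorm Ψ μ f :=
  Real.sInf_nonneg fun _ hl => hl.1.le

theorem bddBelow_luxemburg (Ψ : ℝ → ℝ) (μ : Measure α) (f : α → ℝ) :
    BddBelow {l : ℝ | 0 < l ∧ ∫⁻ x, ENNReal.ofReal (Ψ (f x / l)) ∂μ ≤ 1} :=
  ⟨0, fun _ hl => hl.1.le⟩

theorem luxemburgNorm_le {f : α → ℝ} {l : ℝ} (hl : 0 < l)
    (h : ∫⁻ x, ENNReal.ofReal (Ψ (f x / l)) ∂μ ≤ 1) : luxemburgNorm Ψ μ f ≤ l :=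
  csInf_le (bddBelow_luxemburg Ψ μ f) ⟨hl, h⟩

/-- An `N`-function of quadratic growth that is controlled near the origin. -/
structure IsSubquadratic (Ψ : ℝ → ℝ) (B : ℝ) : Prop where
  isNFunction : IsNFunction Ψ
  pos : 0 < B
  le : ∀ x, Ψ x ≤ 1 / 2 + B * x ^ 2

variable {B : ℝ}

theorem IsSubquadratic.lintegral_le_one [IsProbabilityMeasure μ] (hΨ : IsSubquadratic Ψ B)
    {f : α → ℝ} (hf : MemLp f 2 μ) {l : ℝ} (hl : 0 < l)
    (h : 2 * B * ∫ x, f x ^ 2 ∂μ ≤ l ^ 2) : ∫⁻ x, ENNReal.ofReal (Ψ (f x / l)) ∂μ ≤ 1 := by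
  have hint : Integrable (fun x => 1 / 2 + B * (f x / l) ^ 2) μ := by
    have h2 := (integrable_const (1 / 2 : ℝ)).add (hf.integrable_sq.const_mul (B / l ^ 2))
    refine h2.congr (Eventually.of_forall fun x => ?_)
    simp only [Pi.add_apply]
    rw [div_pow]
    ring
  calc ∫⁻ x, ENNReal.ofReal (Ψ (f x / l)) ∂μ
      ≤ ∫⁻ x, ENNReal.ofReal (1 / 2 + B * (f x / l) ^ 2) ∂μ :=
        lintegral_mono fun x => ENNReal.ofReal_le_ofReal (hΨ.le _)
    _ = ENNReal.ofReal (∫ x, (1 / 2 + B * (f x / l) ^ 2) ∂μ) :=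
        (ofReal_integral_eq_lintegral_ofReal hint (Eventually.of_forall fun x => by
          have := hΨ.pos
          positivity)).symm
    _ ≤ ENNReal.ofReal 1 := by
        refine ENNReal.ofReal_le_ofReal ?_
        have e : ∀ x, 1 / 2 + B * (f x / l) ^ 2 = 1 / 2 + B / l ^ 2 * f x ^ 2 := fun x => by
          rw [div_pow]; ring
        simp only [e]
        rw [integral_add (integrable_const _) (hf.integrable_sq.const_mul _), integral_const,
          integral_const_mul]
        have h3 : B / l ^ 2 * ∫ x, f x ^ 2 ∂μ ≤ 1 / 2 := by
          rw [div_mul_eq_mul_div, div_le_iff₀ (by positivity)]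
          linarith
        simp only [probReal_univ, smul_eq_mul, one_mul]
        linarith
    _ = 1 := ENNReal.ofReal_one

theorem IsSubquadratic.nonempty [IsProbabilityMeasure μ] (hΨ : IsSubquadratic Ψ B)
    {f : α → ℝ} (hf : MemLp f 2 μ) :
    {l : ℝ | 0 < l ∧ ∫⁻ x, ENNReal.ofReal (Ψ (f x / l)) ∂μ ≤ 1}.Nonempty := by
  have h0 : 0 ≤ 2 * B * ∫ x, f x ^ 2 ∂μ :=
    mul_nonneg (by linarith [hΨ.pos]) (integral_nonneg fun x => sq_nonneg _)
  have hl : 0 < 2 * B * (∫ x, f x ^ 2 ∂μ) + 1 := by linarith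
  exact ⟨_, hl, hΨ.lintegral_le_one hf hl (by nlinarith)⟩

theorem IsSubquadratic.luxemburgNorm_le_sqrt [IsProbabilityMeasure μ] (hΨ : IsSubquadratic Ψ B)
    {f : α → ℝ} (hf : MemLp f 2 μ) :
    luxemburgNorm Ψ μ f ≤ √(2 * B * ∫ x, f x ^ 2 ∂μ) := by
  have h0 : 0 ≤ 2 * B * ∫ x, f x ^ 2 ∂μ :=
    mul_nonneg (by linarith [hΨ.pos]) (integral_nonneg fun x => sq_nonneg _)
  -- The square root may vanish, while admissible `l` are positive.
  refine le_of_forall_pos_le_add fun ε hε => ?_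
  have hs := Real.sqrt_nonneg (2 * B * ∫ x, f x ^ 2 ∂μ)
  refine luxemburgNorm_le (by positivity) (hΨ.lintegral_le_one hf (by positivity) ?_)
  nlinarith [Real.sq_sqrt h0]

theorem IsSubquadratic.aemeasurable_comp (hΨ : IsSubquadratic Ψ B) {f : α → ℝ}
    (hf : MemLp f 2 μ) (l : ℝ) : AEMeasurable (fun x => ENNReal.ofReal (Ψ (f x / l))) μ :=
  (hΨ.isNFunction.continuous.measurable.comp_aemeasurable
    (hf.aestronglyMeasurable.aemeasurable.div_const l)).ennreal_ofReal

/-- If `a` and `b` are admissible for `f` and `g`, then `(f + g) / (a + b)` is the convex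
combination of `f / a` and `g / b` with weights `a / (a + b)` and `b / (a + b)`. -/
theorem IsSubquadratic.luxemburgNorm_add_le [IsProbabilityMeasure μ] (hΨ : IsSubquadratic Ψ B)
    {f g : α → ℝ} (hf : MemLp f 2 μ) (hg : MemLp g 2 μ) :
    luxemburgNorm Ψ μ (fun x => f x + g x) ≤ luxemburgNorm Ψ μ f + luxemburgNorm Ψ μ g := by
  have hset : ∀ a ∈ {l : ℝ | 0 < l ∧ ∫⁻ x, ENNReal.ofReal (Ψ (f x / l)) ∂μ ≤ 1},
      ∀ b ∈ {l : ℝ | 0 < l ∧ ∫⁻ x, ENNReal.ofReal (Ψ (g x / l)) ∂μ ≤ 1},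
      luxemburgNorm Ψ μ (fun x => f x + g x) ≤ a + b := by
    rintro a ⟨ha, hfa⟩ b ⟨hb, hgb⟩
    have hab : 0 < a + b := add_pos ha hb
    refine luxemburgNorm_le hab ?_
    have hpt : ∀ x, ENNReal.ofReal (Ψ ((f x + g x) / (a + b))) ≤
        ENNReal.ofReal (a / (a + b)) * ENNReal.ofReal (Ψ (f x / a)) +
        ENNReal.ofReal (b / (a + b)) * ENNReal.ofReal (Ψ (g x / b)) := by
      intro x
      have h1 := hΨ.isNFunction.nonneg (f x / a)
      have h2 := hΨ.isNFunction.nonneg (g x / b)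
      rw [← ENNReal.ofReal_mul (by positivity), ← ENNReal.ofReal_mul (by positivity),
        ← ENNReal.ofReal_add (by positivity) (by positivity)]
      refine ENNReal.ofReal_le_ofReal ?_
      have := hΨ.isNFunction.convexOn.2 (mem_univ (f x / a)) (mem_univ (g x / b))
        (div_nonneg ha.le hab.le) (div_nonneg hb.le hab.le) (by field_simp)
      simp only [smul_eq_mul] at this
      have e : (f x + g x) / (a + b) = a / (a + b) * (f x / a) + b / (a + b) * (g x / b) := by
        field_simp
      rwa [e]
    calc ∫⁻ x, ENNReal.ofReal (Ψ ((f x + g x) / (a + b))) ∂μ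
        ≤ ∫⁻ x, (ENNReal.ofReal (a / (a + b)) * ENNReal.ofReal (Ψ (f x / a)) +
          ENNReal.ofReal (b / (a + b)) * ENNReal.ofReal (Ψ (g x / b))) ∂μ := lintegral_mono hpt
      _ = ENNReal.ofReal (a / (a + b)) * ∫⁻ x, ENNReal.ofReal (Ψ (f x / a)) ∂μ +
          ENNReal.ofReal (b / (a + b)) * ∫⁻ x, ENNReal.ofReal (Ψ (g x / b)) ∂μ := by
        rw [lintegral_add_left' ((hΨ.aemeasurable_comp hf a).const_mul _),
          lintegral_const_mul'' _ (hΨ.aemeasurable_comp hf a),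
          lintegral_const_mul'' _ (hΨ.aemeasurable_comp hg b)]
      _ ≤ ENNReal.ofReal (a / (a + b)) * 1 + ENNReal.ofReal (b / (a + b)) * 1 := by gcongr
      _ = 1 := by
        rw [mul_one, mul_one, ← ENNReal.ofReal_add (by positivity) (by positivity), ← add_div,
          div_self hab.ne', ENNReal.ofReal_one]
  rw [← sub_le_iff_le_add]
  refine le_csInf (hΨ.nonempty hf) fun a ha => ?_
  rw [sub_le_iff_le_add', ← sub_le_iff_le_add]
  refine le_csInf (hΨ.nonempty hg) fun b hb => ?_
  rw [sub_le_iff_le_add, add_comm b a]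
  exact hset a ha b hb

theorem IsSubquadratic.lintegral_le_one_of_lt [IsProbabilityMeasure μ] (hΨ : IsSubquadratic Ψ B)
    {f : α → ℝ} (hf : MemLp f 2 μ) {l : ℝ} (hl : luxemburgNorm Ψ μ f < l) :
    ∫⁻ x, ENNReal.ofReal (Ψ (f x / l)) ∂μ ≤ 1 := by
  obtain ⟨a, ⟨ha, hfa⟩, hal⟩ := (csInf_lt_iff (bddBelow_luxemburg Ψ μ f) (hΨ.nonempty hf)).1 hl
  refine (lintegral_mono fun x => ENNReal.ofReal_le_ofReal ?_).trans hfa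
  refine hΨ.isNFunction.map_le_of_abs_le ?_
  rw [abs_div, abs_div, abs_of_pos ha, abs_of_pos (ha.trans hal)]
  gcongr

/-- Every `l > 0` is admissible, and `Ψ(f) ≤ l Ψ(f / l)` for `l < 1` by convexity; let `l` tend to
`0`. -/
theorem IsSubquadratic.ae_eq_zero [IsProbabilityMeasure μ] (hΨ : IsSubquadratic Ψ B)
    {f : α → ℝ} (hf : MemLp f 2 μ) (h0 : luxemburgNorm Ψ μ f = 0) : f =ᵐ[μ] 0 := by
  have hle : ∀ l ∈ Ioo (0 : ℝ) 1, ∫⁻ x, ENNReal.ofReal (Ψ (f x / 1)) ∂μ ≤ ENNReal.ofReal l := by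
    intro l hl
    have h1 := hΨ.lintegral_le_one_of_lt hf (h0.trans_lt hl.1)
    calc ∫⁻ x, ENNReal.ofReal (Ψ (f x / 1)) ∂μ
        ≤ ∫⁻ x, ENNReal.ofReal l * ENNReal.ofReal (Ψ (f x / l)) ∂μ := by
          refine lintegral_mono fun x => ?_
          rw [← ENNReal.ofReal_mul hl.1.le]
          refine ENNReal.ofReal_le_ofReal ?_
          have := hΨ.isNFunction.map_mul_le hl.1.le hl.2.le (f x / l)
          rw [div_one]
          rwa [mul_div_cancel₀ _ hl.1.ne'] at this
      _ = ENNReal.ofReal l * ∫⁻ x, ENNReal.ofReal (Ψ (f x / l)) ∂μ :=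
          lintegral_const_mul'' _ (hΨ.aemeasurable_comp hf l)
      _ ≤ ENNReal.ofReal l * 1 := by gcongr
      _ = ENNReal.ofReal l := mul_one _
  have hzero : ∫⁻ x, ENNReal.ofReal (Ψ (f x / 1)) ∂μ = 0 := by
    have hlim : Tendsto (fun l : ℝ => ENNReal.ofReal l) (𝓝[>] 0) (𝓝 0) := by
      have := ENNReal.continuous_ofReal.tendsto 0
      rw [ENNReal.ofReal_zero] at this
      exact this.mono_left nhdsWithin_le_nhds
    refine le_antisymm (ge_of_tendsto hlim ?_) zero_le
    filter_upwards [Ioo_mem_nhdsGT zero_lt_one] with l hl using hle l hl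
  rw [lintegral_eq_zero_iff' (hΨ.aemeasurable_comp hf 1)] at hzero
  filter_upwards [hzero] with x hx
  have h1 : Ψ (f x) ≤ 0 := by simpa using hx
  exact (hΨ.isNFunction.eq_zero_iff _).1 (le_antisymm h1 (hΨ.isNFunction.nonneg _))

end Luxemburg

/-! ### Real-valued elements of complex `L²` -/

section RealL2

variable {α : Type*} [MeasurableSpace α] {μ : Measure α}

theorem re_inner_eq_integral (u v : Lp ℂ 2 μ) :
    (inner ℂ u v).re = ∫ x, ((u x).re * (v x).re + (u x).im * (v x).im) ∂μ := by
  rw [L2.inner_def]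
  have h : RCLike.re (∫ x, inner ℂ (u x) (v x) ∂μ) = ∫ x, RCLike.re (inner ℂ (u x) (v x)) ∂μ :=
    (integral_re (L2.integrable_inner u v)).symm
  refine h.trans (integral_congr_ae (Eventually.of_forall fun x => ?_))
  simp
  ring

/-- The real-valued elements of `L²(μ; ℂ)`. -/
def realSubgroup (μ : Measure α) : AddSubgroup (Lp ℂ 2 μ) where
  carrier := {u | ∀ᵐ x ∂μ, (u x).im = 0}
  add_mem' {u v} hu hv := by
    filter_upwards [hu, hv, Lp.coeFn_add u v] with x h1 h2 h3
    rw [h3, Pi.add_apply, Complex.add_im, h1, h2, add_zero]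
  zero_mem' := by
    filter_upwards [Lp.coeFn_zero ℂ 2 μ] with x hx
    rw [hx, Pi.zero_apply, Complex.zero_im]
  neg_mem' {u} hu := by
    filter_upwards [hu, Lp.coeFn_neg u] with x h1 h2
    rw [h2, Pi.neg_apply, Complex.neg_im, h1, neg_zero]

theorem mem_realSubgroup {u : Lp ℂ 2 μ} : u ∈ realSubgroup μ ↔ ∀ᵐ x ∂μ, (u x).im = 0 := Iff.rfl

theorem ofReal_smul_mem_realSubgroup (r : ℝ) (u : Lp ℂ 2 μ) (hu : u ∈ realSubgroup μ) :
    (r : ℂ) • u ∈ realSubgroup μ := by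
  filter_upwards [hu, Lp.coeFn_smul (r : ℂ) u] with x h1 h2
  rw [h2, Pi.smul_apply, smul_eq_mul, Complex.im_ofReal_mul, h1, mul_zero]

theorem isClosed_realSubgroup : IsClosed (realSubgroup μ : Set (Lp ℂ 2 μ)) := by
  have hc : Continuous fun u : Lp ℂ 2 μ => Complex.imCLM.compLp u :=
    (Complex.imCLM.compLpL 2 μ).continuous
  convert (isClosed_singleton (x := (0 : Lp ℝ 2 μ))).preimage hc using 1
  ext u
  simp only [SetLike.mem_coe, mem_realSubgroup, mem_preimage, mem_singleton_iff]
  rw [Lp.eq_zero_iff_ae_eq_zero]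
  have h := Complex.imCLM.coeFn_compLp u
  constructor
  · intro h1
    filter_upwards [h, h1] with x h2 h3
    rw [h2]
    exact h3
  · intro h1
    filter_upwards [h, h1] with x h2 h3
    rw [h2] at h3
    exact h3

theorem memLp_re (u : Lp ℂ 2 μ) : MemLp (fun x => (u x).re) 2 μ := (Lp.memLp u).re

/-- A real function in `L²(μ)` as an element of `L²(μ; ℂ)`. -/
def ofRealLp (f : α → ℝ) (hf : MemLp f 2 μ) : Lp ℂ 2 μ :=
  MemLp.toLp (fun y => (f y : ℂ)) hf.ofReal

theorem coeFn_ofRealLp {f : α → ℝ} (hf : MemLp f 2 μ) :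
    ofRealLp f hf =ᵐ[μ] fun y => (f y : ℂ) := MemLp.coeFn_toLp _

theorem ofRealLp_mem {f : α → ℝ} (hf : MemLp f 2 μ) : ofRealLp f hf ∈ realSubgroup μ := by
  filter_upwards [coeFn_ofRealLp hf] with x hx
  simp [hx]

theorem re_ofRealLp {f : α → ℝ} (hf : MemLp f 2 μ) :
    (fun x => (ofRealLp f hf x).re) =ᵐ[μ] f := by
  filter_upwards [coeFn_ofRealLp hf] with x hx
  simp [hx]

theorem re_inner_of_mem {u v : Lp ℂ 2 μ} (hu : u ∈ realSubgroup μ) :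
    (inner ℂ u v).re = ∫ x, (u x).re * (v x).re ∂μ := by
  rw [re_inner_eq_integral]
  refine integral_congr_ae ?_
  filter_upwards [hu] with x hx
  simp [hx]

theorem norm_sq_of_mem {u : Lp ℂ 2 μ} (hu : u ∈ realSubgroup μ) :
    ‖u‖ ^ 2 = ∫ x, (u x).re ^ 2 ∂μ := by
  have h : (inner ℂ u u).re = ‖u‖ ^ 2 := inner_self_eq_norm_sq (𝕜 := ℂ) u
  rw [← h, re_inner_of_mem hu]
  simp only [sq]

theorem re_inner_ofRealLp {f : α → ℝ} (hf : MemLp f 2 μ) (v : Lp ℂ 2 μ) :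
    (inner ℂ (ofRealLp f hf) v).re = ∫ x, f x * (v x).re ∂μ := by
  rw [re_inner_of_mem (ofRealLp_mem hf)]
  refine integral_congr_ae ?_
  filter_upwards [re_ofRealLp hf] with x hx
  rw [hx]

theorem norm_sq_ofRealLp {f : α → ℝ} (hf : MemLp f 2 μ) :
    ‖ofRealLp f hf‖ ^ 2 = ∫ x, f x ^ 2 ∂μ := by
  rw [norm_sq_of_mem (ofRealLp_mem hf)]
  refine integral_congr_ae ?_
  filter_upwards [re_ofRealLp hf] with x hx
  rw [hx]

end RealL2

/-! ### Gradients, test functions and the closed graph -/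

section Gradient

variable {n : ℕ}

theorem contDiff_complexGradient {φ : EuclideanSpace ℝ (Fin n) → ℂ} (hφ : ContDiff ℝ ∞ φ) :
    Continuous (complexGradient φ) := by
  refine (PiLp.continuous_toLp 2 _).comp (continuous_pi fun i => ?_)
  exact (hφ.continuous_fderiv (by simp)).clm_apply continuous_const

theorem hasCompactSupport_complexGradient {φ : EuclideanSpace ℝ (Fin n) → ℂ} (hφ : HasCompactSupport φ) :
    HasCompactSupport (complexGradient φ) := by
  refine (hφ.fderiv ℝ).mono' ?_
  intro x hx
  refine subset_closure ?_
  rw [Function.mem_support] at hx ⊢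
  contrapose! hx
  ext i
  simp [complexGradient, hx]

theorem norm_sq_complexGradient (φ : EuclideanSpace ℝ (Fin n) → ℂ) (x : EuclideanSpace ℝ (Fin n)) :
    ‖complexGradient φ x‖ ^ 2 = ∑ i, ‖fderiv ℝ φ x (EuclideanSpace.single i 1)‖ ^ 2 := by
  rw [EuclideanSpace.norm_sq_eq]
  rfl

theorem fderiv_ofReal_comp {φ : EuclideanSpace ℝ (Fin n) → ℝ} {x : EuclideanSpace ℝ (Fin n)} (hφ : DifferentiableAt ℝ φ x) (v : EuclideanSpace ℝ (Fin n)) :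
    fderiv ℝ (fun y => (φ y : ℂ)) x v = (fderiv ℝ φ x v : ℂ) := by
  have h : HasFDerivAt (fun y => (φ y : ℂ)) (Complex.ofRealCLM ∘L fderiv ℝ φ x) x :=
    Complex.ofRealCLM.hasFDerivAt.comp x hφ.hasFDerivAt
  rw [h.fderiv]
  rfl

theorem gradient_apply {φ : EuclideanSpace ℝ (Fin n) → ℝ} (x : EuclideanSpace ℝ (Fin n)) (i : Fin n) :
    gradient φ x i = fderiv ℝ φ x (EuclideanSpace.single i 1) := by
  have h := InnerProductSpace.toDual_symm_apply (𝕜 := ℝ) (x := EuclideanSpace.single i (1 : ℝ))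
    (y := fderiv ℝ φ x)
  rw [← h, real_inner_comm, EuclideanSpace.inner_single_left]
  simp [gradient]

theorem norm_complexGradient_ofReal {φ : EuclideanSpace ℝ (Fin n) → ℝ} {x : EuclideanSpace ℝ (Fin n)} (hφ : DifferentiableAt ℝ φ x) :
    ‖complexGradient (fun y => (φ y : ℂ)) x‖ = ‖gradient φ x‖ := by
  rw [← sq_eq_sq₀ (norm_nonneg _) (norm_nonneg _), norm_sq_complexGradient,
    EuclideanSpace.norm_sq_eq]
  refine Finset.sum_congr rfl fun i _ => ?_
  rw [fderiv_ofReal_comp hφ, gradient_apply, Complex.norm_real]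

theorem norm_complexGradient_re_le {φ : EuclideanSpace ℝ (Fin n) → ℂ} {x : EuclideanSpace ℝ (Fin n)} (hφ : DifferentiableAt ℝ φ x) :
    ‖complexGradient (fun y => ((φ y).re : ℂ)) x‖ ≤ ‖complexGradient φ x‖ := by
  rw [← sq_le_sq₀ (norm_nonneg _) (norm_nonneg _), norm_sq_complexGradient,
    norm_sq_complexGradient]
  refine Finset.sum_le_sum fun i _ => ?_
  have h : HasFDerivAt (fun y => (φ y).re) (Complex.reCLM ∘L fderiv ℝ φ x) x :=
    Complex.reCLM.hasFDerivAt.comp x hφ.hasFDerivAt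
  rw [fderiv_ofReal_comp h.differentiableAt, h.fderiv, Complex.norm_real]
  gcongr
  exact Complex.abs_re_le_norm _

theorem complexGradient_add {φ χ : EuclideanSpace ℝ (Fin n) → ℂ} {x : EuclideanSpace ℝ (Fin n)} (hφ : DifferentiableAt ℝ φ x)
    (hχ : DifferentiableAt ℝ χ x) :
    complexGradient (fun y => φ y + χ y) x = complexGradient φ x + complexGradient χ x := by
  ext i
  simp [complexGradient, fderiv_fun_add hφ hχ]

theorem complexGradient_const_mul {φ : EuclideanSpace ℝ (Fin n) → ℂ} {x : EuclideanSpace ℝ (Fin n)} (c : ℂ) (hφ : DifferentiableAt ℝ φ x) :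
    complexGradient (fun y => c * φ y) x = c • complexGradient φ x := by
  ext i
  simp [complexGradient, fderiv_const_mul hφ c]

variable {μ : Measure (EuclideanSpace ℝ (Fin n))}

/-- The pair `(φ, ∇φ)` in `L²(μ; ℂ) × L²(μ; ℂⁿ)`. -/
def graphPair (φ : EuclideanSpace ℝ (Fin n) → ℂ) (h1 : MemLp φ 2 μ) (h2 : MemLp (complexGradient φ) 2 μ) :
    WithLp 2 (Lp ℂ 2 μ × Lp (EuclideanSpace ℂ (Fin n)) 2 μ) :=
  WithLp.toLp 2 (h1.toLp φ, h2.toLp _)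

/-- Smooth functions with compact support. -/
structure IsTest {F : Type*} [NormedAddCommGroup F] [NormedSpace ℝ F] (φ : EuclideanSpace ℝ (Fin n) → F) : Prop where
  contDiff : ContDiff ℝ ∞ φ
  hasCompactSupport : HasCompactSupport φ

theorem IsTest.memLp [IsFiniteMeasure μ] {F : Type*} [NormedAddCommGroup F] [NormedSpace ℝ F] {φ : EuclideanSpace ℝ (Fin n) → F}
    (hφ : IsTest φ) : MemLp φ 2 μ :=
  hφ.contDiff.continuous.memLp_of_hasCompactSupport hφ.hasCompactSupport

theorem IsTest.memLp_gradient [IsFiniteMeasure μ] {φ : EuclideanSpace ℝ (Fin n) → ℂ} (hφ : IsTest φ) :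
    MemLp (complexGradient φ) 2 μ :=
  (contDiff_complexGradient hφ.contDiff).memLp_of_hasCompactSupport
    (hasCompactSupport_complexGradient hφ.hasCompactSupport)

theorem IsTest.ofReal {φ : EuclideanSpace ℝ (Fin n) → ℝ} (hφ : IsTest φ) : IsTest fun x => (φ x : ℂ) where
  contDiff := Complex.ofRealCLM.contDiff.comp hφ.contDiff
  hasCompactSupport := hφ.hasCompactSupport.comp_left Complex.ofReal_zero

theorem IsTest.re {φ : EuclideanSpace ℝ (Fin n) → ℂ} (hφ : IsTest φ) : IsTest fun x => (φ x).re where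
  contDiff := Complex.reCLM.contDiff.comp hφ.contDiff
  hasCompactSupport := hφ.hasCompactSupport.comp_left Complex.zero_re

theorem graphPair_mem [IsFiniteMeasure μ] {φ : EuclideanSpace ℝ (Fin n) → ℂ} (hφ : IsTest φ) :
    graphPair φ hφ.memLp hφ.memLp_gradient ∈ gradientGraph μ :=
  subset_closure (Submodule.subset_span
    ⟨φ, hφ.contDiff, hφ.hasCompactSupport, MemLp.coeFn_toLp hφ.memLp,
      MemLp.coeFn_toLp hφ.memLp_gradient⟩)

theorem exists_graphPair_near [IsFiniteMeasure μ]
    {k : WithLp 2 (Lp ℂ 2 μ × Lp (EuclideanSpace ℂ (Fin n)) 2 μ)} (hk : k ∈ gradientGraph μ)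
    {ε : ℝ} (hε : 0 < ε) :
    ∃ (φ : EuclideanSpace ℝ (Fin n) → ℂ) (hφ : IsTest φ), ‖k - graphPair φ hφ.memLp hφ.memLp_gradient‖ < ε := by
  obtain ⟨p, hp, hkp⟩ := Metric.mem_closure_iff.1 hk ε hε
  -- The pairs `(φ, ∇φ)` are closed under linear combinations, so an element of the span is again
  -- such a pair.
  have hspan : ∃ φ : EuclideanSpace ℝ (Fin n) → ℂ, IsTest φ ∧ (p.fst : EuclideanSpace ℝ (Fin n) → ℂ) =ᵐ[μ] φ ∧
      (p.snd : EuclideanSpace ℝ (Fin n) → EuclideanSpace ℂ (Fin n)) =ᵐ[μ] complexGradient φ := by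
    clear hkp
    induction hp using Submodule.span_induction with
    | mem p hp =>
      obtain ⟨φ, h1, h2, h3, h4⟩ := hp
      exact ⟨φ, ⟨h1, h2⟩, h3, h4⟩
    | zero =>
      refine ⟨0, ⟨contDiff_const, HasCompactSupport.zero⟩, Lp.coeFn_zero _ _ _, ?_⟩
      have : complexGradient (0 : EuclideanSpace ℝ (Fin n) → ℂ) = 0 := by
        ext x i
        simp [complexGradient]
      rw [this]
      exact Lp.coeFn_zero _ _ _
    | add p q _ _ hp hq =>
      obtain ⟨φ, h1, h2, h3⟩ := hp
      obtain ⟨χ, h1', h2', h3'⟩ := hq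
      refine ⟨fun y => φ y + χ y, ⟨h1.contDiff.add h1'.contDiff,
        h1.hasCompactSupport.add h1'.hasCompactSupport⟩, ?_, ?_⟩
      · filter_upwards [h2, h2', Lp.coeFn_add p.fst q.fst] with x e1 e2 e3
        rw [WithLp.add_fst, e3, Pi.add_apply, e1, e2]
      · filter_upwards [h3, h3', Lp.coeFn_add p.snd q.snd] with x e1 e2 e3
        rw [WithLp.add_snd, e3, Pi.add_apply, e1, e2,
          complexGradient_add (h1.contDiff.differentiable (by simp) x)
            (h1'.contDiff.differentiable (by simp) x)]
    | smul c p _ hp =>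
      obtain ⟨φ, h1, h2, h3⟩ := hp
      refine ⟨fun y => c * φ y, ⟨contDiff_const.mul h1.contDiff,
        h1.hasCompactSupport.mul_left⟩, ?_, ?_⟩
      · filter_upwards [h2, Lp.coeFn_smul c p.fst] with x e1 e3
        rw [WithLp.smul_fst, e3, Pi.smul_apply, e1, smul_eq_mul]
      · filter_upwards [h3, Lp.coeFn_smul c p.snd] with x e1 e3
        rw [WithLp.smul_snd, e3, Pi.smul_apply, e1,
          complexGradient_const_mul c (h1.contDiff.differentiable (by simp) x)]
  obtain ⟨φ, hφ, h1, h2⟩ := hspan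
  refine ⟨φ, hφ, ?_⟩
  have hpe : p = graphPair φ hφ.memLp hφ.memLp_gradient := by
    refine (WithLp.ofLp_injective 2) (Prod.ext ?_ ?_)
    · exact Lp.ext (h1.trans (MemLp.coeFn_toLp hφ.memLp).symm)
    · exact Lp.ext (h2.trans (MemLp.coeFn_toLp hφ.memLp_gradient).symm)
  rwa [← hpe, ← dist_eq_norm]

end Gradient

/-! ### Cutoffs, constants in the form domain, real approximation -/

section Cutoff

theorem tendsto_toLp_of_dominated {α F : Type*} [MeasurableSpace α] {μ : Measure α}
    [NormedAddCommGroup F] {f : ℕ → α → F} {g : α → F} {b : α → ℝ} (hf : ∀ k, MemLp (f k) 2 μ)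
    (hg : MemLp g 2 μ) (hb : MemLp b 2 μ) (hfb : ∀ k x, ‖f k x - g x‖ ≤ b x)
    (hlim : ∀ x, Tendsto (fun k => f k x) atTop (𝓝 (g x))) :
    Tendsto (fun k => (hf k).toLp (f k)) atTop (𝓝 (hg.toLp g)) := by
  rw [Lp.tendsto_Lp_iff_tendsto_eLpNorm'']
  have e : ∀ k, eLpNorm (f k - g) 2 μ = (∫⁻ x, ‖f k x - g x‖ₑ ^ (2 : ℝ) ∂μ) ^ (1 / 2 : ℝ) := by
    intro k
    rw [eLpNorm_eq_lintegral_rpow_enorm_toReal two_ne_zero ENNReal.ofNat_ne_top]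
    simp
  simp only [e]
  have h0 : Tendsto (fun k => ∫⁻ x, ‖f k x - g x‖ₑ ^ (2 : ℝ) ∂μ) atTop (𝓝 (∫⁻ _, 0 ∂μ)) := by
    refine tendsto_lintegral_of_dominated_convergence' (fun x => ‖b x‖ₑ ^ (2 : ℝ)) ?_ ?_ ?_ ?_
    · exact fun k => (((hf k).1.sub hg.1).enorm).pow_const _
    · intro k
      refine Eventually.of_forall fun x => ?_
      refine ENNReal.rpow_le_rpow ?_ (by norm_num)
      rw [enorm_le_iff_norm_le]
      exact (hfb k x).trans (Real.le_norm_self _)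
    · have := lintegral_rpow_enorm_lt_top_of_eLpNorm_lt_top two_ne_zero ENNReal.ofNat_ne_top hb.2
      simpa using this.ne
    · refine Eventually.of_forall fun x => ?_
      have h1 : Tendsto (fun k => ‖f k x - g x‖ₑ) atTop (𝓝 0) := by
        have := ((hlim x).sub_const (g x)).enorm
        simpa using this
      have h2 := (ENNReal.continuous_rpow_const (y := 2)).tendsto 0
      rw [ENNReal.zero_rpow_of_pos two_pos] at h2
      exact h2.comp h1
  rw [lintegral_zero] at h0
  have h1 := (ENNReal.continuous_rpow_const (y := 1 / 2)).tendsto 0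
  rw [ENNReal.zero_rpow_of_pos one_half_pos] at h1
  exact h1.comp h0

variable {n : ℕ} {μ : Measure (EuclideanSpace ℝ (Fin n))}

theorem complexGradient_mul {φ χ : EuclideanSpace ℝ (Fin n) → ℂ} {x : EuclideanSpace ℝ (Fin n)}
    (hφ : DifferentiableAt ℝ φ x) (hχ : DifferentiableAt ℝ χ x) :
    complexGradient (fun y => φ y * χ y) x =
      φ x • complexGradient χ x + χ x • complexGradient φ x := by
  ext i
  simp [complexGradient, fderiv_fun_mul hφ hχ]

/-- Smooth cutoff functions. -/
theorem exists_cutoff (n : ℕ) : ∃ (χ : ℕ → EuclideanSpace ℝ (Fin n) → ℂ) (C : ℝ), 0 ≤ C ∧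
    (∀ k, IsTest (χ k)) ∧ (∀ k x, ‖χ k x - 1‖ ≤ 1) ∧ (∀ k x, ‖complexGradient (χ k) x‖ ≤ C) ∧
    (∀ x, ∀ᶠ k in atTop, χ k x = 1 ∧ complexGradient (χ k) x = 0) := by
  let b : ContDiffBump (0 : EuclideanSpace ℝ (Fin n)) := ⟨1, 2, one_pos, one_lt_two⟩
  have hb : ContDiff ℝ ∞ b := b.contDiff
  obtain ⟨C, hC⟩ := (hb.continuous_fderiv (by simp)).bounded_above_of_compact_support
    (b.hasCompactSupport.fderiv ℝ)
  have hpos : ∀ k : ℕ, (0 : ℝ) < k + 1 := fun k => by positivity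
  -- Dilating does not increase the gradient, and near any given point the dilated bump is
  -- eventually `1`. A uniform gradient bound is enough for dominated convergence.
  set χ : ℕ → EuclideanSpace ℝ (Fin n) → ℝ := fun k x => b (((k : ℝ) + 1)⁻¹ • x) with hχ
  have hsm : ∀ k, ContDiff ℝ ∞ (χ k) := fun k => hb.comp (contDiff_const_smul _)
  have hd : ∀ k x, DifferentiableAt ℝ (χ k) x := fun k x => (hsm k).differentiable (by simp) x
  have hgrad : ∀ k x, ‖complexGradient (fun y => (χ k y : ℂ)) x‖ = ‖fderiv ℝ (χ k) x‖ := by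
    intro k x
    rw [norm_complexGradient_ofReal (hd k x), gradient, LinearIsometryEquiv.norm_map]
  refine ⟨fun k x => (χ k x : ℂ), C, (norm_nonneg _).trans (hC 0), fun k => ?_, fun k x => ?_,
    fun k x => ?_, fun x => ?_⟩
  · refine IsTest.ofReal ⟨hsm k, ?_⟩
    exact b.hasCompactSupport.comp_smul (inv_ne_zero (hpos k).ne')
  · rw [← Complex.ofReal_one, ← Complex.ofReal_sub, Complex.norm_real, Real.norm_eq_abs, abs_le]
    have h1 := b.nonneg' (((k : ℝ) + 1)⁻¹ • x)
    have h2 := b.le_one (x := ((k : ℝ) + 1)⁻¹ • x)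
    constructor <;> simp only [hχ] <;> linarith
  · rw [hgrad]
    have h1 : HasFDerivAt (χ k) ((fderiv ℝ b (((k : ℝ) + 1)⁻¹ • x)) ∘L
        (((k : ℝ) + 1)⁻¹ • ContinuousLinearMap.id ℝ (EuclideanSpace ℝ (Fin n)))) x :=
      (hb.differentiable (by simp) _).hasFDerivAt.comp x
        ((((k : ℝ) + 1)⁻¹ • ContinuousLinearMap.id ℝ (EuclideanSpace ℝ (Fin n))).hasFDerivAt)
    rw [h1.fderiv]
    refine (ContinuousLinearMap.opNorm_comp_le _ _).trans ?_
    have h2 : ‖((k : ℝ) + 1)⁻¹ • ContinuousLinearMap.id ℝ (EuclideanSpace ℝ (Fin n))‖ ≤ 1 := by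
      rw [norm_smul, Real.norm_of_nonneg (inv_nonneg.2 (hpos k).le)]
      have h3 : ((k : ℝ) + 1)⁻¹ ≤ 1 := inv_le_one_of_one_le₀ (by linarith [Nat.cast_nonneg (α := ℝ) k])
      have h4 : ‖ContinuousLinearMap.id ℝ (EuclideanSpace ℝ (Fin n))‖ ≤ 1 :=
        ContinuousLinearMap.norm_id_le
      calc _ ≤ (1 : ℝ) * 1 := by gcongr
        _ = 1 := one_mul 1
    calc _ ≤ C * 1 := mul_le_mul (hC _) h2 (norm_nonneg _) ((norm_nonneg _).trans (hC 0))
      _ = C := mul_one C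
  · obtain ⟨N, hN⟩ := exists_nat_gt ‖x‖
    filter_upwards [eventually_ge_atTop N] with k hk
    have hkx : ‖x‖ < (k : ℝ) + 1 := by
      have : (N : ℝ) ≤ k := Nat.cast_le.2 hk
      linarith
    have hmem : ((k : ℝ) + 1)⁻¹ • x ∈ Metric.ball (0 : EuclideanSpace ℝ (Fin n)) b.rIn := by
      rw [mem_ball_zero_iff, norm_smul, Real.norm_of_nonneg (inv_nonneg.2 (hpos k).le),
        inv_mul_lt_iff₀ (hpos k)]
      simpa [b] using hkx
    have hev : χ k =ᶠ[𝓝 x] fun _ => 1 := by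
      have hc : ContinuousAt (fun y : EuclideanSpace ℝ (Fin n) => ((k : ℝ) + 1)⁻¹ • y) x := by
        fun_prop
      exact hc.eventually (b.eventuallyEq_one_of_mem_ball hmem)
    constructor
    · simp [hev.eq_of_nhds]
    · rw [← norm_eq_zero, hgrad, hev.fderiv_eq]
      simp

/-- Truncate by `χ_k`: the extra term `φ ∇χ_k` is dominated by `C |φ|` in `L²` and tends to `0`
pointwise. This admits both the constants and the smooth functions of finite energy. -/
theorem graphPair_mem_of_contDiff [IsFiniteMeasure μ] {φ : EuclideanSpace ℝ (Fin n) → ℂ}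
    (hφ : ContDiff ℝ ∞ φ) (h1 : MemLp φ 2 μ) (h2 : MemLp (complexGradient φ) 2 μ) :
    graphPair φ h1 h2 ∈ gradientGraph μ := by
  obtain ⟨χ, C, hC, hχ, hχ1, hχC, hχlim⟩ := exists_cutoff n
  have hd : ∀ x, DifferentiableAt ℝ φ x := fun x => hφ.differentiable (by simp) x
  have hχd : ∀ k x, DifferentiableAt ℝ (χ k) x := fun k x =>
    (hχ k).contDiff.differentiable (by simp) x
  have htest : ∀ k, IsTest fun x => χ k x * φ x := fun k =>
    ⟨(hχ k).contDiff.mul hφ, (hχ k).hasCompactSupport.mul_right⟩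
  have l1 : Tendsto (fun k => (htest k).memLp.toLp (fun x => χ k x * φ x)) atTop
      (𝓝 (h1.toLp φ)) := by
    refine tendsto_toLp_of_dominated (b := fun x => ‖φ x‖) _ h1 h1.norm (fun k x => ?_)
      fun x => ?_
    · rw [← sub_one_mul, norm_mul]
      exact mul_le_of_le_one_left (norm_nonneg _) (hχ1 k x)
    · refine tendsto_const_nhds.congr' ?_
      filter_upwards [hχlim x] with k hk
      rw [hk.1, one_mul]
  have l2 : Tendsto (fun k => (htest k).memLp_gradient.toLp
      (complexGradient fun x => χ k x * φ x)) atTop (𝓝 (h2.toLp (complexGradient φ))) := by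
    refine tendsto_toLp_of_dominated (b := fun x => ‖complexGradient φ x‖ + C * ‖φ x‖) _ h2
      (h2.norm.add (h1.norm.const_mul C)) (fun k x => ?_) fun x => ?_
    · rw [complexGradient_mul (hχd k x) (hd x)]
      have e : χ k x • complexGradient φ x + φ x • complexGradient (χ k) x - complexGradient φ x =
          (χ k x - 1) • complexGradient φ x + φ x • complexGradient (χ k) x := by
        rw [sub_smul, one_smul]; abel
      rw [e]
      refine (norm_add_le _ _).trans ?_
      rw [norm_smul, norm_smul]
      refine add_le_add (mul_le_of_le_one_left (norm_nonneg _) (hχ1 k x)) ?_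
      rw [mul_comm]
      exact mul_le_mul_of_nonneg_right (hχC k x) (norm_nonneg _)
    · refine tendsto_const_nhds.congr' ?_
      filter_upwards [hχlim x] with k hk
      rw [complexGradient_mul (hχd k x) (hd x), hk.1, hk.2, one_smul, smul_zero, add_zero]
  have hlim : Tendsto (fun k => graphPair _ (htest k).memLp (htest k).memLp_gradient) atTop
      (𝓝 (graphPair φ h1 h2)) :=
    ((WithLp.prod_continuous_toLp 2 _ _).tendsto _).comp (l1.prodMk_nhds l2)
  exact (Submodule.isClosed_topologicalClosure _).mem_of_tendsto hlim
    (Eventually.of_forall fun k => graphPair_mem (htest k))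

theorem resolvent_injective [IsFiniteMeasure μ] : Function.Injective (resolvent μ) := by
  refine graphResolvent_injective _ ?_
  refine (Lp.dense_hasCompactSupport_contDiff (F := ℂ) (μ := μ) (p := 2)
    ENNReal.ofNat_ne_top).mono ?_
  rintro u ⟨g, hug, h1, h2⟩
  have hg : IsTest g := ⟨h2, h1⟩
  exact ⟨_, graphPair_mem hg, Lp.ext ((MemLp.coeFn_toLp hg.memLp).trans hug.symm)⟩

/-- Since `(1, 0)` is in the closed graph, the projection fixes it; the semigroup is therefore
conservative. -/
theorem resolvent_one [IsFiniteMeasure μ] :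
    resolvent μ (ofRealLp (fun _ => 1) (memLp_const 1)) =
      ofRealLp (fun _ => 1) (memLp_const 1) := by
  have h0 : complexGradient (fun _ : EuclideanSpace ℝ (Fin n) => ((1 : ℝ) : ℂ)) = 0 := by
    ext x i
    simp [complexGradient]
  have h2 : MemLp (complexGradient (fun _ : EuclideanSpace ℝ (Fin n) => ((1 : ℝ) : ℂ))) 2 μ := by
    rw [h0]; exact MemLp.zero
  have hk := graphPair_mem_of_contDiff (μ := μ)
    (φ := fun _ : EuclideanSpace ℝ (Fin n) => ((1 : ℝ) : ℂ)) contDiff_const (memLp_const _) h2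
  have h3 : h2.toLp _ = 0 :=
    Lp.ext ((MemLp.coeFn_toLp h2).trans ((EventuallyEq.of_eq h0).trans (Lp.coeFn_zero _ _ _).symm))
  have e : (graphPair (μ := μ) _ (memLp_const _) h2).fst =
    ofRealLp (fun _ => 1) (memLp_const 1) := rfl
  rw [← e]
  exact graphResolvent_eq_self (gradientGraph μ) hk h3

/-- For real data the graph lift is a limit of pairs coming from real test functions. -/
theorem exists_real_graphPair_near [IsFiniteMeasure μ] {a : Lp ℂ 2 μ} (ha : a ∈ realSubgroup μ)
    {ε : ℝ} (hε : 0 < ε) :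
    ∃ (φ : EuclideanSpace ℝ (Fin n) → ℝ) (hφ : IsTest φ), ‖graphLift (gradientGraph μ) a -
      graphPair (fun x => (φ x : ℂ)) hφ.ofReal.memLp hφ.ofReal.memLp_gradient‖ < ε := by
  obtain ⟨φ, hφ, hlt⟩ := exists_graphPair_near (graphLift_mem (gradientGraph μ) a) hε
  refine ⟨fun x => (φ x).re, hφ.re, lt_of_le_of_lt ?_ hlt⟩
  -- As `a` is real, taking real parts brings both components of `(φ, ∇φ)` no farther from `(a, 0)`,
  -- hence by Pythagoras no farther from its projection.
  have p1 := norm_sq_sub_of_mem (gradientGraph μ) (graphPair_mem (μ := μ) hφ) a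
  have p2 := norm_sq_sub_of_mem (gradientGraph μ) (graphPair_mem (μ := μ) hφ.re.ofReal) a
  rw [WithLp.prod_norm_sq_eq_of_L2] at p1 p2
  have q1 : ‖(WithLp.toLp 2 (a, (0 : Lp (EuclideanSpace ℂ (Fin n)) 2 μ)) -
      graphPair (fun x => ((φ x).re : ℂ)) hφ.re.ofReal.memLp hφ.re.ofReal.memLp_gradient).fst‖ ≤
      ‖(WithLp.toLp 2 (a, (0 : Lp (EuclideanSpace ℂ (Fin n)) 2 μ)) -
      graphPair φ hφ.memLp hφ.memLp_gradient).fst‖ := by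
    rw [WithLp.sub_fst, WithLp.sub_fst]
    refine Lp.norm_le_norm_of_ae_le ?_
    filter_upwards [ha, Lp.coeFn_sub a (graphPair φ (μ := μ) hφ.memLp hφ.memLp_gradient).fst,
      Lp.coeFn_sub a (graphPair (μ := μ) (fun x => ((φ x).re : ℂ)) hφ.re.ofReal.memLp
        hφ.re.ofReal.memLp_gradient).fst,
      MemLp.coeFn_toLp (μ := μ) (p := 2) hφ.memLp,
      MemLp.coeFn_toLp (μ := μ) (p := 2) hφ.re.ofReal.memLp] with x h1 h2 h3 h4 h5
    have h4' : (graphPair φ (μ := μ) hφ.memLp hφ.memLp_gradient).fst x = φ x := h4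
    have h5' : (graphPair (μ := μ) (fun x => ((φ x).re : ℂ)) hφ.re.ofReal.memLp
        hφ.re.ofReal.memLp_gradient).fst x = ((φ x).re : ℂ) := h5
    rw [WithLp.toLp_fst, h3, h2, Pi.sub_apply, Pi.sub_apply, h4', h5']
    have e : a x - ((φ x).re : ℂ) = ((a x - φ x).re : ℂ) :=
      Complex.ext (by simp) (by simpa using h1)
    rw [e, Complex.norm_real]
    exact Complex.abs_re_le_norm _
  have q2 : ‖(WithLp.toLp 2 (a, (0 : Lp (EuclideanSpace ℂ (Fin n)) 2 μ)) -
      graphPair (fun x => ((φ x).re : ℂ)) hφ.re.ofReal.memLp hφ.re.ofReal.memLp_gradient).snd‖ ≤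
      ‖(WithLp.toLp 2 (a, (0 : Lp (EuclideanSpace ℂ (Fin n)) 2 μ)) -
      graphPair φ hφ.memLp hφ.memLp_gradient).snd‖ := by
    rw [WithLp.sub_snd, WithLp.sub_snd, WithLp.toLp_snd, zero_sub, zero_sub, norm_neg, norm_neg]
    refine Lp.norm_le_norm_of_ae_le ?_
    filter_upwards [MemLp.coeFn_toLp (μ := μ) (p := 2) hφ.memLp_gradient,
      MemLp.coeFn_toLp (μ := μ) (p := 2) hφ.re.ofReal.memLp_gradient] with x h1 h2
    have h1' : (graphPair φ (μ := μ) hφ.memLp hφ.memLp_gradient).snd x = complexGradient φ x := h1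
    have h2' : (graphPair (μ := μ) (fun x => ((φ x).re : ℂ)) hφ.re.ofReal.memLp
        hφ.re.ofReal.memLp_gradient).snd x = complexGradient (fun x => ((φ x).re : ℂ)) x := h2
    rw [h1', h2']
    exact norm_complexGradient_re_le (hφ.contDiff.differentiable (by simp) x)
  have q3 := pow_le_pow_left₀ (norm_nonneg _) q1 2
  have q4 := pow_le_pow_left₀ (norm_nonneg _) q2 2
  rw [← sq_le_sq₀ (norm_nonneg _) (norm_nonneg _)]
  linarith

end Cutoff

/-! ### Smooth nondecreasing functions and their primitives -/

section Primitive

/-- A smooth nondecreasing Lipschitz function vanishing at the origin. -/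
structure IsSmoothMonotone (η : ℝ → ℝ) (B : ℝ) : Prop where
  contDiff : ContDiff ℝ ∞ η
  map_zero : η 0 = 0
  deriv_nonneg : ∀ x, 0 ≤ deriv η x
  deriv_le : ∀ x, deriv η x ≤ B

variable {η : ℝ → ℝ} {B : ℝ}

theorem IsSmoothMonotone.nonneg (hη : IsSmoothMonotone η B) : 0 ≤ B :=
  (hη.deriv_nonneg 0).trans (hη.deriv_le 0)

theorem IsSmoothMonotone.abs_sub_le (hη : IsSmoothMonotone η B) (x y : ℝ) :
    |η y - η x| ≤ B * |y - x| :=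
  convex_univ.norm_image_sub_le_of_norm_deriv_le
    (fun z _ => hη.contDiff.differentiable (by simp) z)
    (fun z _ => by rw [Real.norm_of_nonneg (hη.deriv_nonneg z)]; exact hη.deriv_le z)
    (mem_univ x) (mem_univ y)

theorem IsSmoothMonotone.abs_le (hη : IsSmoothMonotone η B) (x : ℝ) : |η x| ≤ B * |x| := by
  simpa [hη.map_zero] using hη.abs_sub_le 0 x

/-- The primitive of `η` vanishing at the origin. -/
def primitive (η : ℝ → ℝ) (x : ℝ) : ℝ := ∫ s in (0 : ℝ)..x, η s

theorem IsSmoothMonotone.hasDerivAt_primitive (hη : IsSmoothMonotone η B) (x : ℝ) :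
    HasDerivAt (primitive η) (η x) x :=
  (hη.contDiff.continuous.integral_hasStrictDerivAt 0 x).hasDerivAt

theorem IsSmoothMonotone.continuous_primitive (hη : IsSmoothMonotone η B) :
    Continuous (primitive η) :=
  continuous_iff_continuousAt.2 fun x => (hη.hasDerivAt_primitive x).continuousAt

theorem IsSmoothMonotone.primitive_taylor (hη : IsSmoothMonotone η B) (x y : ℝ) :
    |primitive η y - primitive η x - η x * (y - x)| ≤ B * (y - x) ^ 2 := by
  have h := (convex_uIcc x y).norm_image_sub_le_of_norm_hasDerivWithin_le
    (f := fun z => primitive η z - η x * z) (f' := fun z => η z - η x * 1) (C := B * |y - x|)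
    (fun z _ => ((hη.hasDerivAt_primitive z).sub
      ((hasDerivAt_id z).const_mul (η x))).hasDerivWithinAt)
    (fun z hz => by
      rw [mul_one, Real.norm_eq_abs]
      refine (hη.abs_sub_le x z).trans ?_
      have := hη.nonneg
      have : |z - x| ≤ |y - x| := abs_sub_left_of_mem_uIcc hz
      gcongr) left_mem_uIcc right_mem_uIcc
  rw [Real.norm_eq_abs, Real.norm_eq_abs, mul_assoc, abs_mul_abs_self, ← sq] at h
  refine le_of_eq_of_le ?_ h
  congr 1
  ring

theorem IsSmoothMonotone.abs_primitive_le (hη : IsSmoothMonotone η B) (x : ℝ) :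
    |primitive η x| ≤ B * x ^ 2 := by
  simpa [hη.map_zero, primitive] using hη.primitive_taylor 0 x

/-- A smooth nondecreasing Lipschitz function vanishing exactly on `[0, ∞)`. -/
theorem exists_isSmoothMonotone : ∃ (η : ℝ → ℝ) (B : ℝ), IsSmoothMonotone η B ∧
    (∀ x, 0 ≤ x → η x = 0) ∧ ∀ x < 0, η x < 0 := by
  have hsm : ContDiff ℝ ∞ Real.smoothTransition := Real.smoothTransition.contDiff
  have hmono : Monotone Real.smoothTransition := Real.smoothTransition.monotone
  have hcont : Continuous (deriv Real.smoothTransition) := hsm.continuous_deriv (by simp)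
  obtain ⟨B, hB⟩ := (isCompact_Icc (a := (0 : ℝ)) (b := 1)).exists_bound_of_continuousOn
    hcont.continuousOn
  have hB0 : 0 ≤ B := (norm_nonneg _).trans (hB 0 (by simp))
  have hle : ∀ x, deriv Real.smoothTransition x ≤ B := by
    intro x
    rcases lt_or_ge x 0 with h | h
    · have : Real.smoothTransition =ᶠ[𝓝 x] fun _ => 0 := by
        filter_upwards [Iio_mem_nhds h] with z hz
        exact Real.smoothTransition.zero_of_nonpos (le_of_lt hz)
      rw [this.deriv_eq, deriv_const]
      exact hB0
    rcases le_or_gt x 1 with h1 | h1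
    · exact (Real.le_norm_self _).trans (hB x ⟨h, h1⟩)
    · have : Real.smoothTransition =ᶠ[𝓝 x] fun _ => 1 := by
        filter_upwards [Ioi_mem_nhds h1] with z hz
        exact Real.smoothTransition.one_of_one_le (le_of_lt hz)
      rw [this.deriv_eq, deriv_const]
      exact hB0
  have hd : ∀ x, deriv (fun x => -Real.smoothTransition (-x)) x =
      deriv Real.smoothTransition (-x) := by
    intro x
    have h1 : HasDerivAt Real.smoothTransition (deriv Real.smoothTransition (-x)) (-x) :=
      (hsm.differentiable (by simp) _).hasDerivAt
    have h2 := (h1.comp x (hasDerivAt_neg x)).neg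
    rw [mul_neg_one, neg_neg] at h2
    exact h2.deriv
  refine ⟨fun x => -Real.smoothTransition (-x), B, ⟨?_, ?_, fun x => ?_, fun x => ?_⟩,
    fun x hx => ?_, fun x hx => ?_⟩
  · exact (hsm.comp contDiff_neg).neg
  · simp
  · rw [hd]
    exact hmono.deriv_nonneg
  · rw [hd]
    exact hle _
  · simp [Real.smoothTransition.zero_of_nonpos (neg_nonpos.2 hx)]
  · have := Real.smoothTransition.pos_of_pos (neg_pos.2 hx)
    linarith

end Primitive

/-! ### Reality and dissipativity of the resolvent -/

section Resolvent

variable {n : ℕ} {μ : Measure (EuclideanSpace ℝ (Fin n))} {η : ℝ → ℝ} {B : ℝ}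

theorem IsSmoothMonotone.memLp_comp {α : Type*} [MeasurableSpace α] {μ : Measure α}
    (hη : IsSmoothMonotone η B) {f : α → ℝ} (hf : MemLp f 2 μ) : MemLp (fun x => η (f x)) 2 μ :=
  hf.of_le_mul (hη.contDiff.continuous.comp_aestronglyMeasurable hf.1)
    (Eventually.of_forall fun x => hη.abs_le (f x))

theorem IsTest.comp (hη : IsSmoothMonotone η B) {φ : EuclideanSpace ℝ (Fin n) → ℝ}
    (hφ : IsTest φ) : IsTest fun x => η (φ x) :=
  ⟨hη.contDiff.comp hφ.contDiff, hφ.hasCompactSupport.comp_left hη.map_zero⟩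

theorem complexGradient_comp {φ : EuclideanSpace ℝ (Fin n) → ℝ} {x : EuclideanSpace ℝ (Fin n)}
    (hη : DifferentiableAt ℝ η (φ x)) (hφ : DifferentiableAt ℝ φ x) :
    complexGradient (fun y => ((η (φ y) : ℝ) : ℂ)) x =
      ((deriv η (φ x) : ℝ) : ℂ) • complexGradient (fun y => (φ y : ℂ)) x := by
  have h : HasFDerivAt (fun y => η (φ y)) (deriv η (φ x) • fderiv ℝ φ x) x :=
    hη.hasDerivAt.comp_hasFDerivAt x hφ.hasFDerivAt
  ext i
  simp only [complexGradient, PiLp.smul_apply, smul_eq_mul]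
  rw [fderiv_ofReal_comp h.differentiableAt, fderiv_ofReal_comp hφ, h.fderiv]
  simp

theorem resolvent_mem_realSubgroup [IsFiniteMeasure μ] {a : Lp ℂ 2 μ} (ha : a ∈ realSubgroup μ) :
    resolvent μ a ∈ realSubgroup μ := by
  refine isClosed_realSubgroup.closure_subset (Metric.mem_closure_iff.2 fun ε hε => ?_)
  obtain ⟨φ, hφ, hlt⟩ := exists_real_graphPair_near ha hε
  refine ⟨ofRealLp φ hφ.memLp, ofRealLp_mem _, ?_⟩
  rw [dist_eq_norm, resolvent, ← fst_graphLift]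
  exact lt_of_le_of_lt (WithLp.norm_fst_le _ (graphLift (gradientGraph μ) a -
    graphPair (fun x => (φ x : ℂ)) hφ.ofReal.memLp hφ.ofReal.memLp_gradient)) hlt

theorem isSelfAdjoint_resolvent : IsSelfAdjoint (resolvent μ) := isSelfAdjoint_graphResolvent _

theorem spectrum_resolvent : spectrum ℝ (resolvent μ) ⊆ Icc 0 1 := spectrum_graphResolvent _

theorem functionalCalculus_resolvent_mem_realSubgroup [IsFiniteMeasure μ] {f : ℝ → ℝ}
    (hf : ContinuousOn f (Icc 0 1)) {a : Lp ℂ 2 μ} (ha : a ∈ realSubgroup μ) :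
    functionalCalculus f (resolvent μ) a ∈ realSubgroup μ :=
  functionalCalculus_apply_mem isSelfAdjoint_resolvent spectrum_resolvent hf (realSubgroup μ)
    isClosed_realSubgroup (fun r u hu => ofReal_smul_mem_realSubgroup r u hu)
    (fun _ hu => resolvent_mem_realSubgroup hu) ha

theorem semigroup_mem_realSubgroup [IsFiniteMeasure μ] {t : ℝ} (ht : 0 < t) {a : Lp ℂ 2 μ}
    (ha : a ∈ realSubgroup μ) : semigroup μ t a ∈ realSubgroup μ :=
  functionalCalculus_resolvent_mem_realSubgroup (continuous_heatSymbol ht).continuousOn ha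

theorem re_inner_gradient_comp_nonneg [IsFiniteMeasure μ] (hη : IsSmoothMonotone η B)
    {φ : EuclideanSpace ℝ (Fin n) → ℝ} (hφ : IsTest φ) :
    0 ≤ (inner ℂ ((hφ.comp hη).ofReal.memLp_gradient (μ := μ)).toLp
      (hφ.ofReal.memLp_gradient (μ := μ)).toLp).re := by
  rw [L2.inner_def]
  have hre := integral_re (𝕜 := ℂ) (L2.integrable_inner (𝕜 := ℂ)
    ((hφ.comp hη).ofReal.memLp_gradient (μ := μ)).toLp (hφ.ofReal.memLp_gradient (μ := μ)).toLp)
  refine le_of_le_of_eq ?_ hre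
  refine integral_nonneg_of_ae ?_
  filter_upwards [((hφ.comp hη).ofReal.memLp_gradient (μ := μ)).coeFn_toLp,
    (hφ.ofReal.memLp_gradient (μ := μ)).coeFn_toLp] with x h1 h2
  rw [h1, h2, complexGradient_comp (hη.contDiff.differentiable (by simp) _)
    (hφ.contDiff.differentiable (by simp) _), inner_smul_left, inner_self_eq_norm_sq_to_K]
  simp only [Pi.zero_apply, Complex.conj_ofReal, Complex.coe_algebraMap]
  rw [← Complex.ofReal_pow, ← Complex.ofReal_mul]
  exact mul_nonneg (hη.deriv_nonneg _) (sq_nonneg _)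

theorem norm_gradient_comp_le [IsFiniteMeasure μ] (hη : IsSmoothMonotone η B)
    {φ : EuclideanSpace ℝ (Fin n) → ℝ} (hφ : IsTest φ) :
    ‖((hφ.comp hη).ofReal.memLp_gradient (μ := μ)).toLp‖ ≤
      B * ‖(hφ.ofReal.memLp_gradient (μ := μ)).toLp‖ := by
  refine Lp.norm_le_mul_norm_of_ae_le_mul ?_
  filter_upwards [((hφ.comp hη).ofReal.memLp_gradient (μ := μ)).coeFn_toLp,
    (hφ.ofReal.memLp_gradient (μ := μ)).coeFn_toLp] with x h1 h2
  rw [h1, h2, complexGradient_comp (hη.contDiff.differentiable (by simp) _)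
    (hφ.contDiff.differentiable (by simp) _), norm_smul, Complex.norm_real,
    Real.norm_of_nonneg (hη.deriv_nonneg _)]
  gcongr
  exact hη.deriv_le _

/-- The generator is dissipative against monotone functions: `⟨η(h), h - L h⟩ ≥ ⟨η(h), h⟩`. -/
theorem re_inner_comp_resolvent_nonneg [IsFiniteMeasure μ] (hη : IsSmoothMonotone η B)
    {a : Lp ℂ 2 μ} (ha : a ∈ realSubgroup μ) :
    0 ≤ (inner ℂ (ofRealLp _ (hη.memLp_comp (memLp_re (resolvent μ a))))
      (a - resolvent μ a)).re := by
  set K := gradientGraph μ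
  set p := graphLift K a with hp
  set e := ofRealLp _ (hη.memLp_comp (memLp_re (resolvent μ a))) with he
  have hpf : p.fst = resolvent μ a := fst_graphLift K a
  set C := B * (‖p.snd‖ + 1 + ‖a - resolvent μ a‖)
  -- The weak equation is tested with `η(φ)`, where `(φ, ∇φ)` is within `ε` of `(Ja, ∇Ja)`. Then
  -- `⟨∇η(φ), ∇φ⟩ = ∫ η'(φ)|∇φ|² ≥ 0`, and replacing `∇φ` by `∇Ja` costs `O(ε)`, as `∇η(φ)` stays
  -- bounded in `L²`; its convergence is not needed. The bound `ε < 1` keeps `C` independent of `ε`.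
  have key : ∀ ε ∈ Ioo (0 : ℝ) 1, -(ε * C) ≤ (inner ℂ e (a - resolvent μ a)).re := by
    intro ε hε
    obtain ⟨φ, hφ, hlt⟩ := exists_real_graphPair_near ha hε.1
    set q := graphPair (μ := μ) _ hφ.ofReal.memLp hφ.ofReal.memLp_gradient with hq
    set r := graphPair (μ := μ) _ (hφ.comp hη).ofReal.memLp (hφ.comp hη).ofReal.memLp_gradient
    have hr : r ∈ K := graphPair_mem (hφ.comp hη).ofReal
    have h1 : ‖p.fst - q.fst‖ < ε := (WithLp.norm_fst_le _ (p - q)).trans_lt hlt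
    have h2 : ‖p.snd - q.snd‖ < ε := (WithLp.norm_snd_le _ (p - q)).trans_lt hlt
    have h3 : (inner ℂ r.fst (a - resolvent μ a)).re = (inner ℂ r.snd p.snd).re := by
      have h4 : inner ℂ r.fst p.fst + inner ℂ r.snd p.snd = inner ℂ r.fst a :=
        inner_graphLift K hr a
      rw [inner_sub_right, ← h4, hpf, add_sub_cancel_left]
    have h5 : 0 ≤ (inner ℂ r.snd q.snd).re := re_inner_gradient_comp_nonneg hη hφ
    have h6 : ‖r.snd‖ ≤ B * ‖q.snd‖ := norm_gradient_comp_le hη hφ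
    have h7 : ‖e - r.fst‖ ≤ B * ‖p.fst - q.fst‖ := by
      refine Lp.norm_le_mul_norm_of_ae_le_mul ?_
      filter_upwards [Lp.coeFn_sub e r.fst, Lp.coeFn_sub p.fst q.fst, coeFn_ofRealLp
        (hη.memLp_comp (memLp_re (resolvent μ a))), ((hφ.comp hη).ofReal.memLp (μ := μ)).coeFn_toLp,
        (hφ.ofReal.memLp (μ := μ)).coeFn_toLp] with x g1 g2 g3 g4 g5
      have g4' : r.fst x = ((η (φ x) : ℝ) : ℂ) := g4
      have g5' : q.fst x = (φ x : ℂ) := g5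
      rw [g1, g2, Pi.sub_apply, Pi.sub_apply, he, g3, g4', g5', ← Complex.ofReal_sub,
        Complex.norm_real, Real.norm_eq_abs]
      refine (hη.abs_sub_le _ _).trans ?_
      refine mul_le_mul_of_nonneg_left ?_ hη.nonneg
      have : ((resolvent μ a) x).re - φ x = (p.fst x - (φ x : ℂ)).re := by
        rw [hpf]; simp
      rw [this]
      exact Complex.abs_re_le_norm _
    have hB := hη.nonneg
    have h8 : ‖q.snd‖ ≤ ‖p.snd‖ + 1 := by
      have := norm_sub_norm_le q.snd p.snd
      rw [norm_sub_rev] at this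
      linarith [hε.2]
    have h9 : |(inner ℂ r.snd (p.snd - q.snd)).re| ≤ B * (‖p.snd‖ + 1) * ε := by
      refine (Complex.abs_re_le_norm _).trans ((norm_inner_le_norm _ _).trans ?_)
      exact mul_le_mul (h6.trans (by gcongr)) h2.le (norm_nonneg _) (by positivity)
    have h10 : |(inner ℂ (e - r.fst) (a - resolvent μ a)).re| ≤
        B * ε * ‖a - resolvent μ a‖ := by
      refine (Complex.abs_re_le_norm _).trans ((norm_inner_le_norm _ _).trans ?_)
      exact mul_le_mul_of_nonneg_right (h7.trans (by gcongr)) (norm_nonneg _)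
    rw [inner_sub_right, Complex.sub_re] at h9
    rw [inner_sub_left, Complex.sub_re] at h10
    have h11 := (abs_le.1 h9).1
    have h12 := (abs_le.1 h10).1
    have h13 : ε * C = B * (‖p.snd‖ + 1) * ε + B * ε * ‖a - resolvent μ a‖ := by ring
    linarith
  have hlim : Tendsto (fun ε : ℝ => -(ε * C)) (𝓝[>] 0) (𝓝 0) := by
    have h : Continuous fun ε : ℝ => -(ε * C) := by fun_prop
    have := h.tendsto 0
    rw [zero_mul, neg_zero] at this
    exact this.mono_left nhdsWithin_le_nhds
  refine le_of_tendsto hlim ?_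
  filter_upwards [Ioo_mem_nhdsGT zero_lt_one] with ε hε using key ε hε

end Resolvent

/-! ### Positivity of the semigroup -/

section Positivity

variable {n : ℕ} {μ : Measure (EuclideanSpace ℝ (Fin n))} {η : ℝ → ℝ} {B : ℝ}

theorem integral_re_sq_le {α : Type*} [MeasurableSpace α] {μ : Measure α} (u : Lp ℂ 2 μ) :
    ∫ x, (u x).re ^ 2 ∂μ ≤ ‖u‖ ^ 2 := by
  have h : (inner ℂ u u).re = ‖u‖ ^ 2 := inner_self_eq_norm_sq (𝕜 := ℂ) u
  rw [← h, re_inner_eq_integral]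
  refine integral_mono (memLp_re u).integrable_sq ?_ fun x => ?_
  · have h1 := (memLp_re u).integrable_sq.add ((Lp.memLp u).im).integrable_sq
    simpa only [sq] using! h1
  · have := mul_self_nonneg (u x).im
    simp only [sq]
    linarith

theorem IsSmoothMonotone.integrable_primitive {α : Type*} [MeasurableSpace α] {μ : Measure α}
    (hη : IsSmoothMonotone η B) (u : Lp ℂ 2 μ) :
    Integrable (fun x => primitive η (u x).re) μ := by
  refine ((memLp_re u).integrable_sq.const_mul B).mono'
    (hη.continuous_primitive.comp_aestronglyMeasurable (memLp_re u).1)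
    (Eventually.of_forall fun x => hη.abs_primitive_le _)

theorem IsSmoothMonotone.integral_primitive_taylor {α : Type*} [MeasurableSpace α] {μ : Measure α}
    (hη : IsSmoothMonotone η B) (u v : Lp ℂ 2 μ) :
    |∫ x, primitive η (v x).re ∂μ - ∫ x, primitive η (u x).re ∂μ -
      (inner ℂ (ofRealLp _ (hη.memLp_comp (memLp_re u))) (v - u)).re| ≤ B * ‖v - u‖ ^ 2 := by
  have hi : Integrable (fun x => η (u x).re * ((v - u : Lp ℂ 2 μ) x).re) μ :=
    (hη.memLp_comp (memLp_re u)).integrable_mul (memLp_re (v - u))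
  rw [re_inner_ofRealLp, ← integral_sub (hη.integrable_primitive v) (hη.integrable_primitive u),
    ← integral_sub (f := fun x => primitive η (v x).re - primitive η (u x).re)
      ((hη.integrable_primitive v).sub (hη.integrable_primitive u)) hi]
  refine (abs_integral_le_integral_abs).trans ?_
  refine le_trans ?_ (mul_le_mul_of_nonneg_left (integral_re_sq_le (v - u)) hη.nonneg)
  rw [← integral_const_mul]
  refine integral_mono_ae
    (((hη.integrable_primitive v).sub (hη.integrable_primitive u)).sub hi).abs
    ((memLp_re (v - u)).integrable_sq.const_mul B) ?_
  filter_upwards [Lp.coeFn_sub v u] with x hx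
  simp only [hx, Pi.sub_apply, Complex.sub_re]
  exact hη.primitive_taylor _ _

/-- The time derivative is `⟨η(P_s a), L P_s a⟩ ≤ 0` by dissipativity, and strong continuity gives
the value at time `0`. -/
theorem integral_primitive_semigroup_le [IsFiniteMeasure μ] (hη : IsSmoothMonotone η B)
    {a : Lp ℂ 2 μ} (ha : a ∈ realSubgroup μ) {t : ℝ} (ht : 0 < t) :
    ∫ x, primitive η (semigroup μ t a x).re ∂μ ≤ ∫ x, primitive η (a x).re ∂μ := by
  set G : Lp ℂ 2 μ → ℝ := fun u => ∫ x, primitive η (u x).re ∂μ with hG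
  have hderiv : ∀ s > 0, ∃ d ≤ 0, HasDerivAt (fun s => G (semigroup μ s a)) d s := by
    intro s hs
    have h1 := hasDerivAt_comp_expOfResolvent (isSelfAdjoint_resolvent (μ := μ))
      (spectrum_resolvent (μ := μ)) hs a (g := G)
      (fun v => hη.integral_primitive_taylor (expOfResolvent (resolvent μ) s a) v)
    refine ⟨_, ?_, h1⟩
    have hb : functionalCalculus (heatQuotient s) (resolvent μ) a ∈ realSubgroup μ :=
      functionalCalculus_resolvent_mem_realSubgroup (continuous_heatQuotient hs).continuousOn ha
    have h2 := re_inner_comp_resolvent_nonneg hη hb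
    have e := expOfResolvent_apply_eq (isSelfAdjoint_resolvent (μ := μ))
      (spectrum_resolvent (μ := μ)) hs a
    simp only [← e] at h2
    rw [← e, ← neg_sub, inner_neg_right, Complex.neg_re]
    linarith
  have hanti : AntitoneOn (fun s => G (semigroup μ s a)) (Ioi 0) := by
    refine antitoneOn_of_deriv_nonpos (convex_Ioi 0) (fun s hs => ?_) (fun s hs => ?_)
      (fun s hs => ?_)
    · obtain ⟨d, _, h⟩ := hderiv s hs
      exact h.continuousAt.continuousWithinAt
    · obtain ⟨d, _, h⟩ := hderiv s (interior_subset hs)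
      exact h.differentiableAt.differentiableWithinAt
    · obtain ⟨d, hd, h⟩ := hderiv s (interior_subset hs)
      rw [h.deriv]
      exact hd
  have hcont : Tendsto (fun s => G (semigroup μ s a)) (𝓝[>] 0) (𝓝 (G a)) := by
    have h0 := tendsto_expOfResolvent_zero (isSelfAdjoint_resolvent (μ := μ))
      (spectrum_resolvent (μ := μ)) resolvent_injective a
    have h1 : Tendsto (fun v : Lp ℂ 2 μ => (inner ℂ (ofRealLp _ (hη.memLp_comp (memLp_re a)))
        (v - a)).re) (𝓝 a) (𝓝 0) := by
      have hc : Continuous fun v : Lp ℂ 2 μ =>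
        (inner ℂ (ofRealLp _ (hη.memLp_comp (memLp_re a))) (v - a)).re :=
        Complex.continuous_re.comp (continuous_const.inner (continuous_id.sub continuous_const))
      simpa using hc.tendsto a
    have h2 : Tendsto (fun v : Lp ℂ 2 μ => B * ‖v - a‖ ^ 2) (𝓝 a) (𝓝 0) := by
      have hc : Continuous fun v : Lp ℂ 2 μ => B * ‖v - a‖ ^ 2 := by fun_prop
      simpa using hc.tendsto a
    have h3 := squeeze_zero_norm (f := fun v : Lp ℂ 2 μ => G v - G a -
      (inner ℂ (ofRealLp _ (hη.memLp_comp (memLp_re a))) (v - a)).re)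
      (fun v => hη.integral_primitive_taylor a v) h2
    have h4 := (h3.add h1).add_const (G a)
    simp only [sub_add_cancel, zero_add] at h4
    exact h4.comp h0
  refine ge_of_tendsto hcont ?_
  filter_upwards [Ioo_mem_nhdsGT ht] with s hs
  exact hanti (mem_Ioi.2 hs.1) (mem_Ioi.2 ht) hs.2.le

/-- Take `η` zero on `[0, ∞)` and negative before: its primitive is positive exactly on the negative
half-line, and its integral, `0` initially, cannot increase. -/
theorem semigroup_nonneg [IsFiniteMeasure μ] {a : Lp ℂ 2 μ} (ha : a ∈ realSubgroup μ)
    (h0 : ∀ᵐ x ∂μ, 0 ≤ (a x).re) {t : ℝ} (ht : 0 < t) :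
    ∀ᵐ x ∂μ, 0 ≤ (semigroup μ t a x).re := by
  obtain ⟨η, B, hη, hpos, hneg⟩ := exists_isSmoothMonotone
  have hP0 : ∀ x, 0 ≤ x → primitive η x = 0 := by
    intro x hx
    rw [primitive, intervalIntegral.integral_congr (g := fun _ => 0), intervalIntegral.integral_zero]
    intro s hs
    rw [uIcc_of_le hx] at hs
    exact hpos s hs.1
  have hPneg : ∀ x < 0, 0 < primitive η x := by
    intro x hx
    rw [primitive, intervalIntegral.integral_symm, ← intervalIntegral.integral_neg]
    refine intervalIntegral.intervalIntegral_pos_of_pos_on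
      (hη.contDiff.continuous.neg.intervalIntegrable _ _) (fun s hs => ?_) hx
    exact neg_pos.2 (hneg s hs.2)
  have hP : ∀ x, 0 ≤ primitive η x := fun x => by
    rcases le_or_gt 0 x with h | h
    exacts [(hP0 x h).ge, (hPneg x h).le]
  have h1 := integral_primitive_semigroup_le hη ha ht
  have h2 : ∫ x, primitive η (a x).re ∂μ = 0 := by
    refine integral_eq_zero_of_ae ?_
    filter_upwards [h0] with x hx using hP0 _ hx
  rw [h2] at h1
  have h3 := (integral_eq_zero_iff_of_nonneg (fun x => hP _)
    (hη.integrable_primitive (semigroup μ t a))).1 (le_antisymm h1 (integral_nonneg fun x => hP _))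
  filter_upwards [h3] with x hx
  by_contra! h
  exact (hPneg _ h).ne' hx

end Positivity

/-! ### Markov property, Jensen's inequality, contraction of the Luxemburg norm -/

section Markov

variable {n : ℕ} {μ : Measure (EuclideanSpace ℝ (Fin n))} {f g : EuclideanSpace ℝ (Fin n) → ℝ}

theorem heat_eq {t : ℝ} (hf : MemLp f 2 μ) :
    heat μ t f hf = fun x => (semigroup μ t (ofRealLp f hf) x).re := rfl

theorem memLp_heat {t : ℝ} (hf : MemLp f 2 μ) : MemLp (heat μ t f hf) 2 μ := memLp_re _

theorem semigroup_one [IsFiniteMeasure μ] {t : ℝ} (ht : 0 < t) :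
    semigroup μ t (ofRealLp (fun _ => 1) (memLp_const 1)) =
      ofRealLp (fun _ => 1) (memLp_const 1) := by
  have h := functionalCalculus_apply_of_fixed (isSelfAdjoint_resolvent (μ := μ))
    spectrum_resolvent (continuous_heatSymbol ht).continuousOn (resolvent_one (μ := μ))
  have h1 : heatSymbol t 1 = 1 := by rw [heatSymbol_of_pos _ one_pos]; simp
  rw [h1, Complex.ofReal_one, one_smul] at h
  exact h

theorem inner_semigroup_left {t : ℝ} (u v : Lp ℂ 2 μ) :
    inner ℂ (semigroup μ t u) v = inner ℂ u (semigroup μ t v) :=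
  inner_cfc_left _ _ _

/-- Symmetry of `P_t` together with `P_t 1 = 1`. -/
theorem integral_heat [IsFiniteMeasure μ] {t : ℝ} (ht : 0 < t) (hf : MemLp f 2 μ) :
    ∫ x, heat μ t f hf x ∂μ = ∫ x, f x ∂μ := by
  have h1 := re_inner_ofRealLp (memLp_const (μ := μ) (p := 2) (1 : ℝ))
    (semigroup μ t (ofRealLp f hf))
  rw [← inner_semigroup_left, semigroup_one ht, re_inner_ofRealLp] at h1
  simp only [one_mul] at h1
  rw [heat_eq, ← h1]
  exact integral_congr_ae (re_ofRealLp hf)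

theorem heat_affine [IsFiniteMeasure μ] {t : ℝ} (ht : 0 < t) (hf : MemLp f 2 μ) (a c : ℝ)
    (h : MemLp (fun x => a * f x + c) 2 μ) :
    heat μ t (fun x => a * f x + c) h =ᵐ[μ] fun x => a * heat μ t f hf x + c := by
  have e : ofRealLp (fun x => a * f x + c) h = (a : ℂ) • ofRealLp f hf +
      (c : ℂ) • ofRealLp (fun _ => 1) (memLp_const 1) := by
    refine Lp.ext ?_
    filter_upwards [coeFn_ofRealLp h, coeFn_ofRealLp hf,
      coeFn_ofRealLp (memLp_const (μ := μ) (p := 2) (1 : ℝ)),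
      Lp.coeFn_add ((a : ℂ) • ofRealLp f hf)
        ((c : ℂ) • ofRealLp (fun _ => 1) (memLp_const (μ := μ) (p := 2) (1 : ℝ))),
      Lp.coeFn_smul (a : ℂ) (ofRealLp f hf),
      Lp.coeFn_smul (c : ℂ) (ofRealLp (fun _ => 1) (memLp_const (μ := μ) (p := 2) (1 : ℝ)))]
      with x h1 h2 h3 h4 h5 h6
    rw [h1, h4, Pi.add_apply, h5, h6, Pi.smul_apply, Pi.smul_apply, h2, h3]
    simp
  rw [heat_eq, e, map_add, map_smul, map_smul, semigroup_one ht]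
  filter_upwards [Lp.coeFn_add ((a : ℂ) • semigroup μ t (ofRealLp f hf))
        ((c : ℂ) • ofRealLp (fun _ => 1) (memLp_const (μ := μ) (p := 2) (1 : ℝ))),
      coeFn_ofRealLp (memLp_const (μ := μ) (p := 2) (1 : ℝ)),
      Lp.coeFn_smul (a : ℂ) (semigroup μ t (ofRealLp f hf)),
      Lp.coeFn_smul (c : ℂ) (ofRealLp (fun _ => 1) (memLp_const (μ := μ) (p := 2) (1 : ℝ)))]
      with x h4 h3 h5 h6
  rw [h4, Pi.add_apply, h5, h6, Pi.smul_apply, Pi.smul_apply, h3, heat_eq]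
  simp

theorem heat_mono [IsFiniteMeasure μ] {t : ℝ} (ht : 0 < t) (hf : MemLp f 2 μ) (hg : MemLp g 2 μ)
    (hfg : ∀ x, f x ≤ g x) : heat μ t f hf ≤ᵐ[μ] heat μ t g hg := by
  have hmem : ofRealLp g hg - ofRealLp f hf ∈ realSubgroup μ :=
    (realSubgroup μ).sub_mem (ofRealLp_mem hg) (ofRealLp_mem hf)
  have h0 : ∀ᵐ x ∂μ, 0 ≤ ((ofRealLp g hg - ofRealLp f hf : Lp ℂ 2 μ) x).re := by
    filter_upwards [Lp.coeFn_sub (ofRealLp g hg) (ofRealLp f hf), coeFn_ofRealLp hf,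
      coeFn_ofRealLp hg] with x h1 h2 h3
    rw [h1, Pi.sub_apply, h2, h3]
    simpa using hfg x
  have h4 := semigroup_nonneg hmem h0 ht
  rw [map_sub] at h4
  filter_upwards [h4, Lp.coeFn_sub (semigroup μ t (ofRealLp g hg))
    (semigroup μ t (ofRealLp f hf))] with x h5 h6
  rw [h6, Pi.sub_apply, Complex.sub_re] at h5
  exact sub_nonneg.1 h5

/-- Jensen's inequality for the Markov semigroup. -/
theorem integral_comp_heat_le [IsProbabilityMeasure μ] {t : ℝ} (ht : 0 < t) (hf : MemLp f 2 μ)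
    {φ : ℝ → ℝ} (hφ : ConvexOn ℝ univ φ) (hc : Continuous φ)
    (hint : ∀ g, MemLp g 2 μ → Integrable (fun x => φ (g x)) μ) :
    ∫ x, φ (heat μ t f hf x) ∂μ ≤ ∫ x, φ (f x) ∂μ := by
  obtain ⟨l, c, hle, hsup⟩ := hφ.real_univ_sSup_of_nat_affine_eq hc.lowerSemicontinuous
  set A : ℕ → ℝ → ℝ := fun i x => l i 1 * x + c i with hA
  have hl : ∀ i x, l i x = l i 1 * x := fun i x => by
    have := (l i).map_smul x 1
    rw [smul_eq_mul, smul_eq_mul, mul_one] at this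
    rw [this, mul_comm]
  have hAle : ∀ i x, A i x ≤ φ x := fun i x => by
    have := hle i x
    rw [Pi.add_apply, hl] at this
    exact this
  have hAsup : ∀ x, ⨆ i, A i x = φ x := by
    intro x
    have := congrFun hsup x
    rw [iSup_apply] at this
    rw [← this]
    exact iSup_congr fun i => by rw [Pi.add_apply, hl]; rfl
  -- Finite maxima of affine functions map `L²` to `L²`, so `P_t` applies to `S k (f)`, whereas
  -- `φ(f)` is only known to be integrable. They increase to `φ`.
  set S : ℕ → ℝ → ℝ := fun k x => partialSups (fun i => A i x) k with hS
  have hSle : ∀ k x, S k x ≤ φ x := fun k x =>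
    partialSups_le _ _ _ fun i _ => hAle i x
  have hSlim : ∀ x, Tendsto (fun k => S k x) atTop (𝓝 (φ x)) := by
    intro x
    have hb : BddAbove (range fun k => S k x) := ⟨φ x, by rintro _ ⟨k, rfl⟩; exact hSle k x⟩
    have h1 := tendsto_atTop_ciSup (partialSups (fun i => A i x)).monotone hb
    have hb' : BddAbove (range fun i => A i x) := ⟨φ x, by rintro _ ⟨k, rfl⟩; exact hAle k x⟩
    rwa [ciSup_partialSups_eq hb', hAsup] at h1
  have hSmem : ∀ (g : EuclideanSpace ℝ (Fin n) → ℝ), MemLp g 2 μ → ∀ k,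
      MemLp (fun x => S k (g x)) 2 μ := by
    intro g hg k
    have haff : ∀ i, MemLp (fun x => A i (g x)) 2 μ := fun i =>
      (hg.const_mul (l i 1)).add (memLp_const (c i))
    induction k with
    | zero => simpa [hS] using haff 0
    | succ k ih =>
      simp only [hS, partialSups_add_one]
      exact ih.sup (haff (k + 1))
  have hstep : ∀ k, ∫ x, S k (heat μ t f hf x) ∂μ ≤ ∫ x, φ (f x) ∂μ := by
    intro k
    have hk := hSmem f hf k
    have h1 : ∀ᵐ x ∂μ, S k (heat μ t f hf x) ≤ heat μ t (fun x => S k (f x)) hk x := by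
      -- `P_t` commutes with affine maps and preserves order: `A_i(P_t f) = P_t(A_i(f)) ≤
      -- P_t(S_k(f))`.
      have h2 : ∀ i ≤ k, ∀ᵐ x ∂μ, A i (heat μ t f hf x) ≤ heat μ t (fun x => S k (f x)) hk x := by
        intro i hi
        have hai : MemLp (fun x => l i 1 * f x + c i) 2 μ :=
          (hf.const_mul (l i 1)).add (memLp_const (c i))
        filter_upwards [heat_affine ht hf (l i 1) (c i) hai, heat_mono ht hai hk
          (fun x => le_partialSups_of_le (fun i => A i (f x)) hi)] with x e1 e2
        rw [e1] at e2
        exact e2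
      have h3 : ∀ᵐ x ∂μ, ∀ i, i ≤ k → A i (heat μ t f hf x) ≤
          heat μ t (fun x => S k (f x)) hk x := by
        rw [ae_all_iff]
        intro i
        by_cases hi : i ≤ k
        · filter_upwards [h2 i hi] with x hx _ using hx
        · exact Eventually.of_forall fun x h => absurd h hi
      filter_upwards [h3] with x hx
      exact partialSups_le _ _ _ hx
    calc ∫ x, S k (heat μ t f hf x) ∂μ
        ≤ ∫ x, heat μ t (fun x => S k (f x)) hk x ∂μ :=
          integral_mono_ae ((hSmem _ (memLp_heat hf) k).integrable one_le_two)
            ((memLp_heat hk).integrable one_le_two) h1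
      _ = ∫ x, S k (f x) ∂μ := integral_heat ht hk
      _ ≤ ∫ x, φ (f x) ∂μ :=
          integral_mono (hk.integrable one_le_two) (hint f hf) fun x => hSle k _
  refine le_of_tendsto' (integral_tendsto_of_tendsto_of_monotone
    (fun k => (hSmem _ (memLp_heat hf) k).integrable one_le_two) (hint _ (memLp_heat hf))
    (Eventually.of_forall fun x => (partialSups (fun i => A i (heat μ t f hf x))).monotone)
    (Eventually.of_forall fun x => hSlim _)) hstep

/-- Every `l` admissible for `f` is admissible for `P_t f`, by Jensen for `x ↦ Ψ(x / l)`. -/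
theorem luxemburgNorm_heat_le [IsProbabilityMeasure μ] {Ψ : ℝ → ℝ} {B : ℝ}
    (hΨ : IsSubquadratic Ψ B) {t : ℝ} (ht : 0 < t) (hf : MemLp f 2 μ) :
    luxemburgNorm Ψ μ (heat μ t f hf) ≤ luxemburgNorm Ψ μ f := by
  refine csInf_le_csInf (bddBelow_luxemburg _ _ _) (hΨ.nonempty hf) ?_
  rintro l ⟨hl, hfl⟩
  refine ⟨hl, ?_⟩
  have hc : Continuous fun x => Ψ (x / l) :=
    hΨ.isNFunction.continuous.comp (continuous_id.div_const l)
  have hint : ∀ g : EuclideanSpace ℝ (Fin n) → ℝ, MemLp g 2 μ →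
      Integrable (fun x => Ψ (g x / l)) μ := by
    intro g hg
    refine ((integrable_const (1 / 2 : ℝ)).add (hg.integrable_sq.const_mul (B / l ^ 2))).mono'
      (hc.comp_aestronglyMeasurable hg.1) (Eventually.of_forall fun x => ?_)
    rw [Real.norm_of_nonneg (hΨ.isNFunction.nonneg _)]
    refine (hΨ.le _).trans_eq ?_
    simp only [Pi.add_apply]
    rw [div_pow]
    ring
  have hconv : ConvexOn ℝ univ fun x => Ψ (x / l) := by
    refine ⟨convex_univ, fun x _ y _ a b ha hb hab => ?_⟩
    have := hΨ.isNFunction.convexOn.2 (mem_univ (x / l)) (mem_univ (y / l)) ha hb hab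
    simp only [smul_eq_mul] at this ⊢
    refine le_trans (le_of_eq ?_) this
    congr 1
    ring
  have h := integral_comp_heat_le ht hf hconv hc hint
  rw [← ofReal_integral_eq_lintegral_ofReal (hint _ (memLp_heat hf))
    (Eventually.of_forall fun x => hΨ.isNFunction.nonneg _)]
  rw [← ofReal_integral_eq_lintegral_ofReal (hint _ hf)
    (Eventually.of_forall fun x => hΨ.isNFunction.nonneg _)] at hfl
  exact (ENNReal.ofReal_le_ofReal h).trans hfl

end Markov

/-! ### Variances as squared norms -/

section Variance

variable {n : ℕ} {μ : Measure (EuclideanSpace ℝ (Fin n))} {f : EuclideanSpace ℝ (Fin n) → ℝ}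

theorem memLp_sub_integral [IsFiniteMeasure μ] (hf : MemLp f 2 μ) :
    MemLp (fun x => f x - ∫ y, f y ∂μ) 2 μ := hf.sub (memLp_const _)

theorem variance_eq_norm_sq [IsProbabilityMeasure μ] (hf : MemLp f 2 μ) :
    variance f μ = ‖ofRealLp _ (memLp_sub_integral hf)‖ ^ 2 := by
  rw [norm_sq_ofRealLp, variance_eq_integral hf.1.aemeasurable]

theorem variance_heat_eq [IsProbabilityMeasure μ] {t : ℝ} (ht : 0 < t) (hf : MemLp f 2 μ) :
    variance (heat μ t f hf) μ = ‖semigroup μ t (ofRealLp _ (memLp_sub_integral hf))‖ ^ 2 := by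
  rw [norm_sq_of_mem (semigroup_mem_realSubgroup ht (ofRealLp_mem _)),
    variance_eq_integral (memLp_heat hf).1.aemeasurable, integral_heat ht hf]
  have hg := memLp_sub_integral hf
  have haff : ∀ (φ : EuclideanSpace ℝ (Fin n) → ℝ) (hφ : MemLp φ 2 μ) (c : ℝ),
      (φ = fun x => 1 * f x + c) → heat μ t φ hφ =ᵐ[μ] fun x => 1 * heat μ t f hf x + c := by
    rintro _ hφ c rfl
    exact heat_affine ht hf 1 c hφ
  have h := haff _ hg (-∫ y, f y ∂μ) (by ext x; ring)
  refine integral_congr_ae ?_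
  filter_upwards [h] with x hx
  rw [heat_eq] at hx
  simp only [hx]
  ring

end Variance

/-! ### Energy of smooth functions and the two implications -/

section Energy

variable {n : ℕ} {μ : Measure (EuclideanSpace ℝ (Fin n))} {f : EuclideanSpace ℝ (Fin n) → ℝ}

theorem eLpNorm_two_sq {α F : Type*} [MeasurableSpace α] {μ : Measure α} [NormedAddCommGroup F]
    (g : α → F) : eLpNorm g 2 μ ^ 2 = ∫⁻ x, ‖g x‖ₑ ^ 2 ∂μ := by
  rw [eLpNorm_eq_lintegral_rpow_enorm_toReal two_ne_zero ENNReal.ofNat_ne_top,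
    ← ENNReal.rpow_natCast, ← ENNReal.rpow_mul]
  simp

theorem enorm_complexGradient_ofReal (hf : ContDiff ℝ ∞ f) (x : EuclideanSpace ℝ (Fin n)) :
    ‖complexGradient (fun y => (f y : ℂ)) x‖ₑ = ‖gradient f x‖ₑ := by
  rw [← ofReal_norm, ← ofReal_norm,
    norm_complexGradient_ofReal (hf.differentiable (by simp) x)]

theorem lintegral_gradient_eq (hf : ContDiff ℝ ∞ f)
    (h : MemLp (complexGradient fun y => (f y : ℂ)) 2 μ) :
    ∫⁻ x, ‖gradient f x‖ₑ ^ 2 ∂μ = ENNReal.ofReal (‖h.toLp‖ ^ 2) := by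
  simp only [← enorm_complexGradient_ofReal hf]
  rw [← eLpNorm_two_sq, Lp.norm_toLp, ← ENNReal.toReal_pow,
    ENNReal.ofReal_toReal (ENNReal.pow_ne_top h.2.ne)]

theorem memLp_complexGradient (hf : ContDiff ℝ ∞ f) (h : ∫⁻ x, ‖gradient f x‖ₑ ^ 2 ∂μ ≠ ⊤) :
    MemLp (complexGradient fun y => (f y : ℂ)) 2 μ := by
  refine ⟨(contDiff_complexGradient
    (Complex.ofRealCLM.contDiff.comp hf)).aestronglyMeasurable, ?_⟩
  simp only [← enorm_complexGradient_ofReal hf] at h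
  rw [← eLpNorm_two_sq] at h
  exact lt_top_iff_ne_top.2 fun h' => h (by rw [h']; rfl)

theorem gradient_sub_const (f : EuclideanSpace ℝ (Fin n) → ℝ) (c : ℝ)
    (x : EuclideanSpace ℝ (Fin n)) : gradient (fun y => f y - c) x = gradient f x := by
  rw [gradient, gradient, fderiv_sub_const]

theorem variance_eq_zero_of_luxemburgNorm [IsProbabilityMeasure μ] {Ψ : ℝ → ℝ} {B : ℝ}
    (hΨ : IsSubquadratic Ψ B) (hf : MemLp f 2 μ)
    (h : luxemburgNorm Ψ μ (fun x => f x - ∫ y, f y ∂μ) = 0) : variance f μ = 0 := by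
  rw [variance_eq_integral hf.1.aemeasurable]
  refine integral_eq_zero_of_ae ?_
  filter_upwards [hΨ.ae_eq_zero (memLp_sub_integral hf) h] with x hx
  simp only [hx, Pi.zero_apply]
  norm_num

/-- Decay of the variance implies the Nash-type inequality. -/
theorem DecayBound.nashInequality [IsProbabilityMeasure μ] {Ψ : ℝ → ℝ} {B : ℝ}
    (hΨ : IsSubquadratic Ψ B) {m : ℝ → ℝ} (hm_smooth : ContDiffOn ℝ 1 m (Ioi 0))
    (hm_bij : BijOn m (Ioi 0) (Ioi 0)) {γ : ℝ} (hγ : 0 < γ) (hm_D : ConditionD m γ)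
    (hdecay : DecayBound μ m Ψ) : NashInequality μ (rate m) Ψ (8 / γ) := by
  intro f hf hfL
  set g : EuclideanSpace ℝ (Fin n) → ℝ := fun x => f x - ∫ y, f y ∂μ with hg_def
  have hgL : MemLp g 2 μ := memLp_sub_integral hfL
  have hg : ContDiff ℝ ∞ g := hf.sub contDiff_const
  have hgrad : ∫⁻ x, ‖gradient f x‖ₑ ^ 2 ∂μ = ∫⁻ x, ‖gradient g x‖ₑ ^ 2 ∂μ :=
    lintegral_congr fun x => by rw [hg_def, gradient_sub_const]
  have hC : 0 < 8 / γ := by positivity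
  rw [hgrad]
  by_cases htop : ∫⁻ x, ‖gradient g x‖ₑ ^ 2 ∂μ = ⊤
  · rw [htop, ENNReal.mul_top (ENNReal.ofReal_pos.2 hC).ne']
    exact le_top
  rcases eq_or_lt_of_le (variance_nonneg f μ) with hv | hv
  · rw [← hv, zero_mul, ENNReal.ofReal_zero]
    exact zero_le
  have hN : 0 < luxemburgNorm Ψ μ g := by
    refine lt_of_le_of_ne (luxemburgNorm_nonneg _ _ _) fun h => ?_
    exact hv.ne' (variance_eq_zero_of_luxemburgNorm hΨ hfL h.symm)
  have h2 := memLp_complexGradient hg htop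
  have hgc : ContDiff ℝ ∞ fun y => (g y : ℂ) := Complex.ofRealCLM.contDiff.comp hg
  have hk := graphPair_mem_of_contDiff hgc hgL.ofReal h2
  rw [lintegral_gradient_eq hg h2, ← ENNReal.ofReal_mul hC.le]
  refine ENNReal.ofReal_le_ofReal ?_
  have hvn := variance_eq_norm_sq hfL
  refine mul_rate_le_of_decay hm_smooth hm_bij hγ hm_D hv (by positivity) fun t ht => ?_
  have hd := hdecay t ht f hfL
  rw [variance_heat_eq ht hfL] at hd
  refine le_trans ?_ hd
  have h0 : ofRealLp g hgL ≠ 0 := by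
    intro h
    have h' : variance f μ = 0 := by
      rw [hvn]
      change ‖ofRealLp g hgL‖ ^ 2 = 0
      rw [h]; simp
    exact hv.ne' h'
  -- The spectral Jensen inequality bounds the decay from below; the hypothesis bounds it from
  -- above.
  have hlog := norm_sq_mul_exp_le (gradientGraph μ) hk h0 ht
  rw [hvn]
  exact hlog

theorem integral_ofRealLp [IsFiniteMeasure μ] (hf : MemLp f 2 μ) :
    (inner ℂ (ofRealLp (fun _ => 1) (memLp_const 1)) (ofRealLp f hf)).re = ∫ x, f x ∂μ := by
  rw [re_inner_ofRealLp]
  refine integral_congr_ae ?_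
  filter_upwards [re_ofRealLp hf] with x hx
  rw [hx, one_mul]

theorem integral_sub_integral_sq_le [IsProbabilityMeasure μ] (hf : MemLp f 2 μ) :
    ∫ x, (f x - ∫ y, f y ∂μ) ^ 2 ∂μ ≤ ∫ x, f x ^ 2 ∂μ := by
  rw [← variance_eq_integral hf.1.aemeasurable, variance_eq_sub hf]
  simp only [Pi.pow_apply]
  linarith [sq_nonneg (∫ y, f y ∂μ)]

/-- The Nash-type inequality extends to the range of the resolvent. -/
theorem NashInequality.mul_rate_le_resolvent [IsProbabilityMeasure μ] {Ψ : ℝ → ℝ} {B : ℝ}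
    (hΨ : IsSubquadratic Ψ B) {θ : ℝ → ℝ} (hθ_mono : MonotoneOn θ (Ioi 0))
    (hθ_cont : ∀ x > 0, ContinuousAt θ x) {C : ℝ} (hC : 0 ≤ C) (hNash : NashInequality μ θ Ψ C)
    {b : Lp ℂ 2 μ} (hb : b ∈ realSubgroup μ)
    (hmean : ∫ x, (resolvent μ b x).re ∂μ = 0) {N : ℝ} (hN : 0 < N)
    (hbN : luxemburgNorm Ψ μ (fun x => (resolvent μ b x).re) ≤ N)
    (hpos : 0 < ‖resolvent μ b‖) :
    ‖resolvent μ b‖ ^ 2 * θ (1 / 2 * (‖resolvent μ b‖ ^ 2 / N ^ 2)) ≤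
      C * ‖(graphLift (gradientGraph μ) b).snd‖ ^ 2 := by
  set h := resolvent μ b with hh
  set p := graphLift (gradientGraph μ) b with hp
  have hpf : p.fst = h := fst_graphLift _ b
  have hreal : h ∈ realSubgroup μ := resolvent_mem_realSubgroup hb
  choose φ hφ hlt using fun j : ℕ =>
    exists_real_graphPair_near hb (show (0 : ℝ) < 1 / ((j : ℝ) + 1) by positivity)
  set q := fun j => graphPair (μ := μ) _ (hφ j).ofReal.memLp (hφ j).ofReal.memLp_gradient with hq
  have hqlim : Tendsto q atTop (𝓝 p) := by
    rw [tendsto_iff_norm_sub_tendsto_zero]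
    refine squeeze_zero (fun _ => norm_nonneg _) (fun j => ?_) tendsto_one_div_add_atTop_nhds_zero_nat
    rw [norm_sub_rev]
    exact (hlt j).le
  have hfst : Tendsto (fun j => (q j).fst) atTop (𝓝 h) := by
    rw [← hpf]
    exact (WithLp.continuous_fst 2 _ _).tendsto p |>.comp hqlim
  have hsnd : Tendsto (fun j => (q j).snd) atTop (𝓝 p.snd) :=
    (WithLp.continuous_snd 2 _ _).tendsto p |>.comp hqlim
  have hqf : ∀ j, (q j).fst = ofRealLp (φ j) (hφ j).memLp := fun j => rfl
  have hmean_lim : Tendsto (fun j => ∫ x, φ j x ∂μ) atTop (𝓝 0) := by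
    have hc : Continuous fun u : Lp ℂ 2 μ =>
        (inner ℂ (ofRealLp (fun _ => 1) (memLp_const 1)) u).re :=
      Complex.continuous_re.comp (continuous_const.inner continuous_id)
    have h1 := (hc.tendsto h).comp hfst
    rw [re_inner_ofRealLp] at h1
    simp only [one_mul, hmean] at h1
    refine h1.congr fun j => ?_
    rw [Function.comp_apply, hqf, integral_ofRealLp]
  set v := fun j => variance (φ j) μ with hv
  have hvlim : Tendsto v atTop (𝓝 (‖h‖ ^ 2)) := by
    have h1 := (hfst.norm.pow 2).sub (hmean_lim.pow 2)
    rw [zero_pow two_ne_zero, sub_zero] at h1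
    refine h1.congr fun j => ?_
    simp only [hv]
    rw [variance_eq_sub (hφ j).memLp, hqf, norm_sq_ofRealLp]
    rfl
  -- This bounds the Luxemburg norm of the centred error `φ_j - h`; centring does not increase the
  -- `L²` norm.
  set δ := fun j => √(2 * B * ‖(q j).fst - h‖ ^ 2) with hδ
  have hδlim : Tendsto δ atTop (𝓝 0) := by
    have h1 := (tendsto_iff_norm_sub_tendsto_zero.1 hfst)
    have h2 := ((h1.pow 2).const_mul (2 * B)).sqrt
    rw [zero_pow two_ne_zero, mul_zero, Real.sqrt_zero] at h2
    exact h2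
  set N' := fun j => luxemburgNorm Ψ μ (fun x => φ j x - ∫ y, φ j y ∂μ) with hN'
  have hN'le : ∀ j, N' j ≤ N + δ j := by
    intro j
    have hd : MemLp (fun x => φ j x - (h x).re) 2 μ := (hφ j).memLp.sub (memLp_re h)
    have hdi : ∫ y, (φ j y - (h y).re) ∂μ = ∫ y, φ j y ∂μ := by
      rw [integral_sub ((hφ j).memLp.integrable one_le_two) ((memLp_re h).integrable one_le_two),
        hmean, sub_zero]
    have hd2 := memLp_sub_integral hd
    have e : (fun x => φ j x - ∫ y, φ j y ∂μ) = fun x => (h x).re +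
        ((φ j x - (h x).re) - ∫ y, (φ j y - (h y).re) ∂μ) := by
      ext x
      rw [hdi]
      ring
    have h1 := hΨ.luxemburgNorm_add_le (memLp_re h) hd2
    rw [← e] at h1
    refine h1.trans (add_le_add hbN ((hΨ.luxemburgNorm_le_sqrt hd2).trans ?_))
    refine Real.sqrt_le_sqrt (mul_le_mul_of_nonneg_left ?_ (by linarith [hΨ.pos]))
    refine (integral_sub_integral_sq_le hd).trans_eq ?_
    rw [norm_sq_of_mem ((realSubgroup μ).sub_mem (by rw [hqf]; exact ofRealLp_mem _) hreal)]
    refine integral_congr_ae ?_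
    filter_upwards [Lp.coeFn_sub (q j).fst h, coeFn_ofRealLp (hφ j).memLp (μ := μ)] with x h1 h2
    rw [h1, Pi.sub_apply, hqf, h2]
    simp
  have hpos2 : 0 < ‖h‖ ^ 2 := by positivity
  have hx0 : 0 < 1 / 2 * (‖h‖ ^ 2 / N ^ 2) := by positivity
  have hδ0 : ∀ j, 0 ≤ δ j := fun j => Real.sqrt_nonneg _
  have hargs : Tendsto (fun j => 1 / 2 * (v j / (N + δ j) ^ 2)) atTop
      (𝓝 (1 / 2 * (‖h‖ ^ 2 / N ^ 2))) := by
    have h1 := (hδlim.const_add N).pow 2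
    rw [add_zero] at h1
    exact (hvlim.div h1 (by positivity)).const_mul _
  have hleft : Tendsto (fun j => v j * θ (1 / 2 * (v j / (N + δ j) ^ 2))) atTop
      (𝓝 (‖h‖ ^ 2 * θ (1 / 2 * (‖h‖ ^ 2 / N ^ 2)))) :=
    hvlim.mul ((hθ_cont _ hx0).tendsto.comp hargs)
  have hright : Tendsto (fun j => C * ‖(q j).snd‖ ^ 2) atTop (𝓝 (C * ‖p.snd‖ ^ 2)) :=
    (hsnd.norm.pow 2).const_mul C
  refine le_of_tendsto_of_tendsto hleft hright ?_
  filter_upwards [hvlim.eventually (lt_mem_nhds hpos2)] with j hvj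
  -- Needed because division by a zero norm would give `θ` the value at `0`, outside the range where
  -- it is monotone.
  have hN'pos : 0 < N' j := by
    refine lt_of_le_of_ne (luxemburgNorm_nonneg _ _ _) fun h => ?_
    exact hvj.ne' (variance_eq_zero_of_luxemburgNorm hΨ (hφ j).memLp h.symm)
  have hNδ : 0 < N + δ j := add_pos_of_pos_of_nonneg hN (hδ0 j)
  -- Only an upper bound for `N' j` is available; monotonicity of `θ` replaces it by the convergent
  -- `N + δ j`, and continuity of `θ` then allows the limit.
  have h1 : θ (1 / 2 * (v j / (N + δ j) ^ 2)) ≤ θ (1 / 2 * (v j / N' j ^ 2)) := by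
    refine hθ_mono (mem_Ioi.2 (by positivity)) (mem_Ioi.2 (by positivity)) ?_
    have := hN'le j
    gcongr
  have h2 := hNash (φ j) (hφ j).contDiff (hφ j).memLp
  rw [lintegral_gradient_eq (hφ j).contDiff (hφ j).ofReal.memLp_gradient,
    ← ENNReal.ofReal_mul hC] at h2
  have h3 := (ENNReal.ofReal_le_ofReal_iff (by positivity)).1 h2
  exact (mul_le_mul_of_nonneg_left h1 hvj.le).trans h3

/-- The Nash-type inequality implies decay of the variance. -/
theorem NashInequality.decayBound [IsProbabilityMeasure μ] {Ψ : ℝ → ℝ} {B : ℝ}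
    (hΨ : IsSubquadratic Ψ B) {m : ℝ → ℝ} (hm_smooth : ContDiffOn ℝ 1 m (Ioi 0))
    (hm_anti : StrictAntiOn m (Ioi 0)) (hm_bij : BijOn m (Ioi 0) (Ioi 0))
    (hm'_bij : BijOn (deriv m) (Ioi 0) (Iio 0)) (hθ_mono : MonotoneOn (rate m) (Ioi 0))
    (hNash : NashInequality μ (rate m) Ψ 2) : DecayBound μ m Ψ := by
  intro t ht f hf
  have hgL := memLp_sub_integral hf
  set g : EuclideanSpace ℝ (Fin n) → ℝ := fun x => f x - ∫ y, f y ∂μ with hg_def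
  set N := luxemburgNorm Ψ μ g with hN_def
  have hN0 : 0 ≤ N := luxemburgNorm_nonneg _ _ _
  have hmt : 0 < m t := hm_bij.mapsTo ht
  rw [variance_heat_eq ht hf]
  change ‖semigroup μ t (ofRealLp g hgL)‖ ^ 2 ≤ m t * N ^ 2
  set G := ofRealLp g hgL with hG
  have hGreal : G ∈ realSubgroup μ := ofRealLp_mem hgL
  -- If `P_t G ≠ 0`, monotonicity of the norm keeps it positive on `(0, t]`, as the clock argument
  -- requires.
  by_cases hzero : semigroup μ t G = 0
  · rw [hzero, norm_zero, zero_pow two_ne_zero]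
    positivity
  have hN : 0 < N := by
    refine lt_of_le_of_ne hN0 fun h => hzero ?_
    have h1 := hΨ.ae_eq_zero hgL h.symm
    have h2 : G = 0 := by
      refine Lp.ext ?_
      filter_upwards [h1, coeFn_ofRealLp hgL, Lp.coeFn_zero ℂ 2 μ] with x h3 h4 h5
      rw [h4, h3, h5]
      simp
    rw [h2, map_zero]
  set b : ℝ → Lp ℂ 2 μ := fun s => functionalCalculus (heatQuotient s) (resolvent μ) G with hb
  set d : ℝ → ℝ := fun s => ‖(graphLift (gradientGraph μ) (b s)).snd‖ ^ 2 with hd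
  have hPs : ∀ s > 0, semigroup μ s G = resolvent μ (b s) := fun s hs =>
    expOfResolvent_apply_eq isSelfAdjoint_resolvent spectrum_resolvent hs G
  -- Here `d s` is the energy of `P_s G = J (b s)`. The squared norm has remainder exactly `‖v - P_s
  -- G‖²`, whence `B = 1`, and `⟨Jb, Jb - b⟩ = -‖∇Jb‖²` by the resolvent equation.
  have hderiv : ∀ s > 0, HasDerivAt (fun s => ‖semigroup μ s G‖ ^ 2) (-(2 * d s)) s := by
    intro s hs
    have h1 := hasDerivAt_comp_expOfResolvent (isSelfAdjoint_resolvent (μ := μ))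
      (spectrum_resolvent (μ := μ)) hs G (g := fun u => ‖u‖ ^ 2)
      (e := (2 : ℂ) • semigroup μ s G) (B := 1) (fun v => by
        have h2 := norm_sub_sq (𝕜 := ℂ) v (semigroup μ s G)
        have h3 : (inner ℂ (semigroup μ s G) (semigroup μ s G)).re = ‖semigroup μ s G‖ ^ 2 :=
          inner_self_eq_norm_sq (𝕜 := ℂ) _
        have h4 := inner_re_symm (𝕜 := ℂ) v (semigroup μ s G)
        simp only [RCLike.re_to_complex] at h2 h4
        rw [h4] at h2
        change |‖v‖ ^ 2 - ‖semigroup μ s G‖ ^ 2 -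
          (inner ℂ ((2 : ℂ) • semigroup μ s G) (v - semigroup μ s G)).re| ≤
          1 * ‖v - semigroup μ s G‖ ^ 2
        rw [one_mul, inner_smul_left, inner_sub_right]
        have h5 : ((starRingEnd ℂ) 2 * (inner ℂ (semigroup μ s G) v -
            inner ℂ (semigroup μ s G) (semigroup μ s G))).re =
            2 * ((inner ℂ (semigroup μ s G) v).re - ‖semigroup μ s G‖ ^ 2) := by
          rw [← h3]
          simp
        rw [h5]
        have h6 : ‖v‖ ^ 2 - ‖semigroup μ s G‖ ^ 2 -
            2 * ((inner ℂ (semigroup μ s G) v).re - ‖semigroup μ s G‖ ^ 2) =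
            ‖v - semigroup μ s G‖ ^ 2 := by
          rw [h2]; ring
        rw [h6, abs_of_nonneg (sq_nonneg _)])
    refine h1.congr_deriv ?_
    symm
    change -(2 * d s) = (inner ℂ ((2 : ℂ) • semigroup μ s G) (resolvent μ (b s) - b s)).re
    have h7 := norm_sq_graphLift (gradientGraph μ) (b s)
    rw [WithLp.prod_norm_sq_eq_of_L2, fst_graphLift] at h7
    change ‖resolvent μ (b s)‖ ^ 2 + d s = (inner ℂ (resolvent μ (b s)) (b s)).re at h7
    have h8 : (inner ℂ (resolvent μ (b s)) (resolvent μ (b s))).re = ‖resolvent μ (b s)‖ ^ 2 :=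
      inner_self_eq_norm_sq (𝕜 := ℂ) _
    rw [hPs s hs, inner_smul_left, inner_sub_right]
    have h9 : ((starRingEnd ℂ) 2 * (inner ℂ (resolvent μ (b s)) (resolvent μ (b s)) -
        inner ℂ (resolvent μ (b s)) (b s))).re =
        2 * ((inner ℂ (resolvent μ (b s)) (resolvent μ (b s))).re -
        (inner ℂ (resolvent μ (b s)) (b s)).re) := by simp
    rw [h9]
    linarith
  have hanti : AntitoneOn (fun s => ‖semigroup μ s G‖ ^ 2) (Ioi 0) := by
    refine antitoneOn_of_deriv_nonpos (convex_Ioi 0)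
      (fun s hs => (hderiv s hs).continuousAt.continuousWithinAt)
      (fun s hs => (hderiv s (interior_subset hs)).differentiableAt.differentiableWithinAt)
      (fun s hs => ?_)
    rw [(hderiv s (interior_subset hs)).deriv]
    have : 0 ≤ d s := sq_nonneg _
    linarith
  have hpos : ∀ s ∈ Ioc 0 t, 0 < ‖semigroup μ s G‖ ^ 2 := fun s hs =>
    (show 0 < ‖semigroup μ t G‖ ^ 2 by positivity).trans_le (hanti hs.1 (mem_Ioi.2 ht) hs.2)
  refine le_mul_of_rate_le hm_smooth hm_anti hm_bij hm'_bij (by positivity) ht hderiv hpos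
    fun s hs => ?_
  rw [neg_neg]
  have hbs : b s ∈ realSubgroup μ :=
    functionalCalculus_resolvent_mem_realSubgroup (continuous_heatQuotient hs.1).continuousOn hGreal
  have hgmean : ∫ x, g x ∂μ = 0 := by
    rw [hg_def, integral_sub (hf.integrable one_le_two) (integrable_const _)]
    simp
  have hheat := integral_heat hs.1 hgL
  have hlux := luxemburgNorm_heat_le hΨ hs.1 hgL
  rw [heat_eq] at hheat hlux
  change ∫ x, (semigroup μ s G x).re ∂μ = _ at hheat
  change luxemburgNorm Ψ μ (fun x => (semigroup μ s G x).re) ≤ N at hlux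
  rw [hgmean] at hheat
  have hps := hpos s hs
  rw [hPs s hs.1] at hheat hlux hps ⊢
  exact hNash.mul_rate_le_resolvent hΨ hθ_mono
    (fun x hx => continuousAt_rate hm_smooth hm_anti hm_bij hx) zero_le_two hbs hheat hN hlux
    (by
      by_contra! h
      rw [le_antisymm h (norm_nonneg _)] at hps
      norm_num at hps)

end Energy

end NashDecay

end

theorem mainTheorem12 {n : ℕ} (V : EuclideanSpace ℝ (Fin n) → ℝ) (hV : Differentiable ℝ V)
    (hμ : IsProbabilityMeasure (NashDecay.gibbsMeasure V))
    (m : ℝ → ℝ) (γ : ℝ) (hγ : 0 < γ)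
    (hm_smooth : ContDiffOn ℝ 1 m (Ioi 0))
    (hm_anti : StrictAntiOn m (Ioi 0))
    (hm_bij : BijOn m (Ioi 0) (Ioi 0))
    (hm_D : NashDecay.ConditionD m γ)
    (hm'_mono : StrictMonoOn (deriv m) (Ioi 0))
    (hm'_bij : BijOn (deriv m) (Ioi 0) (Iio 0))
    (Φ ψ : ℝ → ℝ)
    (hΦ : NashDecay.IsNFunction Φ)
    (hΨ : NashDecay.IsNFunction (NashDecay.quotientFunction ψ))
    (hψ_cont : ContinuousOn ψ (Ici 0))
    (hψ_mono : StrictMonoOn ψ (Ici 0))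
    (hψ_zero : ψ 0 = 0)
    (hψ_top : Tendsto ψ atTop atTop)
    (hθ : ∀ x > 0, NashDecay.rate m x =
      NashDecay.invNonneg (NashDecay.conjugate Φ)
        (NashDecay.quotientFunction ψ (NashDecay.invNonneg ψ x))) :
    (NashDecay.DecayBound (NashDecay.gibbsMeasure V) m (NashDecay.quotientFunction ψ) →
      NashDecay.NashInequality (NashDecay.gibbsMeasure V) (NashDecay.rate m)
        (NashDecay.quotientFunction ψ) (8 / γ)) ∧
    (NashDecay.NashInequality (NashDecay.gibbsMeasure V) (NashDecay.rate m)
        (NashDecay.quotientFunction ψ) 2 →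
      NashDecay.DecayBound (NashDecay.gibbsMeasure V) m (NashDecay.quotientFunction ψ)) := by
  have := hμ
  obtain ⟨B, hB, hle⟩ := NashDecay.exists_quotientFunction_le hΨ hψ_mono hψ_zero
  have hS : NashDecay.IsSubquadratic (NashDecay.quotientFunction ψ) B := ⟨hΨ, hB, hle⟩
  exact ⟨fun h => h.nashInequality hS hm_smooth hm_bij hγ hm_D,
    fun h => h.decayBound hS hm_smooth hm_anti hm_bij hm'_bij
      (NashDecay.monotoneOn_rate hΦ hΨ hψ_cont hψ_mono hψ_zero hψ_top hθ)⟩
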